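/- Let $\Lambda$ be a left cancellative small category; we identify objects with identity morphisms, write $s,r$ for source and range, write $\alpha\beta$ for the composite when $s(\alpha)=r(\beta)$, put $v\Lambda=\{\alpha: r(\alpha)=v\}$, $\alpha\Lambda=\{\alpha\beta : r(\beta)=s(\alpha)\}$, $\alpha\le\beta$ if $\beta\in\alpha\Lambda$, and let $\Lambda^{-1}$ be the set of (right) invertible morphisms. Assume that $\Lambda$ is finitely aligned: each $\alpha\Lambda\cap\beta\Lambda$ is a finite union of sets $\gamma\Lambda$. Let $\Gamma$ be a submonoid of a group $Q$ with $\Gamma\cap\Gamma^{-1}=\{1\}$ and let $\mathbf d:\Lambda\to\Gamma$ be a length function ($\mathbf d(\alpha\beta)=\mathbf d(\alpha)\mathbf d(\beta)$ whenever $s(\alpha)=r(\beta)$) satisfying the weak factorization property: whenever $\mathbf d(\alpha)=\gamma_1\gamma_2$ with $\gamma_i\in\Gamma$ there are $\alpha_1,\alpha_2$ with $\alpha=\alpha_1\alpha_2$ and $\mathbf d(\alpha_i)=\gamma_i$, such that for every other such factorization $\alpha=\beta_1\beta_2$, $\mathbf d(\beta_i)=\gamma_i$, there are $g_1,g_2\in\Lambda^{-1}$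 with $\beta_1=\alpha_1g_1$, $\beta_2=g_2\alpha_2$. Let $\mathcal G$ be a discrete groupoid acting on $\Lambda$, that is, with a groupoid homomorphism $\phi$, bijective on units (so we identify $\mathcal G^{(0)}=\Lambda^0$), into the groupoid $\mathrm{PIso}(\Lambda,\mathbf d)$ of bijections $f:v\Lambda\to w\Lambda$ ($v,w\in\Lambda^0$) with $f(v)=w$, $f(\alpha\Lambda)=f(\alpha)\Lambda$ and $\mathbf d(f(\alpha))=\mathbf d(\alpha)$; write $g\cdot\alpha=\phi(g)(\alpha)$. Let $\varphi:\{(g,\alpha)\in\mathcal G\times\Lambda: s(g)=r(\alpha)\}\to\mathcal G$ be a category cocycle, i.e. $\varphi(gh,\alpha)=\varphi(g,h\cdot\alpha)\varphi(h,\alpha)$, $\varphi(g,s(g))=g$, $s(\varphi(g,\alpha))=s(\alpha)$, $r(\varphi(g,\alpha))=s(g\cdot\alpha)$, $\varphi(r(\alpha),\alpha)=s(\alpha)$, $\varphi(g,\alpha\beta)=\varphi(\varphi(g,\alpha),\beta)$ and $g\cdot(\alpha\beta)=(g\cdot\alpha)(\varphi(g,\alpha)\cdot\beta)$ whenever these make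 sense. Let $\Lambda\Join^\varphi\mathcal G=\{(\alpha,g): s(\alpha)=r(g)\}$ be the Zappa–Szép product, the (finitely aligned, left cancellative) small category with $r(\alpha,g)=(r(\alpha),r(\alpha))$, $s(\alpha,g)=(s(g),s(g))$ and $(\alpha,g)(\beta,h)=(\alpha(g\cdot\beta),\varphi(g,\beta)h)$. Assume that the category system $(\Lambda,\mathbf d,\mathcal G,\varphi)$ is pseudo-free: (i) if $f\in\Lambda^{-1}$ and $f\alpha=\alpha$, then $f=r(\alpha)$; (ii) if $f\in\Lambda^{-1}$, $g\cdot\alpha=f\alpha$ and $\varphi(g,\alpha)=s(\alpha)$, then $g\in\mathcal G^{(0)}$. For a finitely aligned left cancellative small category $\Delta$, let $\Delta^*$ be the set of nonempty, hereditary ($\alpha\le\beta\in F\Rightarrow\alpha\in F$), upwards directed subsets of $\Delta$, let $\Delta^{**}$ be the set of its maximal elements with respect to inclusion, and let $\Delta_{tight}$ be the set of $C\in\Delta^*$ such that for every $\alpha\in C$ and every finite $K\subseteq\Delta$ with $C\cap K=\emptyset$ there is $D\in\Delta^{**}$ with $\alpha\in D$, $D\cap K=\emptyset$; its topology is generated by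 the sets $\{C:\alpha\in C\}$ and $\{C:\alpha\notin C\}$. Let $\mathcal S_\Delta$ be the inverse semigroup of partial bijections of $\Delta$ generated by the maps $\tau^\alpha: s(\alpha)\Delta\to\alpha\Delta$, $\beta\mapsto\alpha\beta$, and their inverses $\sigma^\alpha$. The tight groupoid $\mathcal G_{tight}(\Delta)$ consists of the classes $[s,F]$ of pairs with $s\in\mathcal S_\Delta$, $F\in\Delta_{tight}$, $F\cap\mathrm{dom}(s)\ne\emptyset$, where $(s,F)\sim(t,F)$ if $se=te$ for some idempotent $e\in\mathcal S_\Delta$ with $F\cap\mathrm{dom}(e)\neq\emptyset$; $[s,F]$ has source $F$ and range $s\cdot F=\{\delta:\delta\le s(\gamma)\text{ for some }\gamma\in F\cap\mathrm{dom}(s)\}$, $[s,t\cdot F][t,F]=[st,F]$, $[s,F]^{-1}=[s^*,s\cdot F]$, and its topology is generated by the sets $\{[s,F]: F\in U,\ F\cap\mathrm{dom}(s)\ne\emptyset\}$ with $s\in\mathcal S_\Delta$ and $U\subseteq\Delta_{tight}$ open. Then $\mathcal G_{tight}(\Lambda\Join^\varphi\mathcal G)$ is a Hausdorff groupoid, i.e.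 a topological groupoid whose topology is Hausdorff. -/

import Mathlib

open CategoryTheory

universe v u v₁ u₁ uQ

namespace LCSC

section SmallCategories

/-- The set of all morphisms of a (small) category `C`; an element `α` has a source `α.s` and a
range `α.r`. -/
structure Mor (C : Type u) [Category.{v} C] where
  s : C
  r : C
  hom : s ⟶ r

variable {C : Type u} [Category.{v} C]

/-- The identity morphism at an object. -/
abbrev Mor.id (x : C) : Mor C := ⟨x, x, 𝟙 x⟩

/-- The product `α β` (first `β`, then `α`), defined when `s(α) = r(β)`. -/
abbrev Mor.comp (α β : Mor C) (h : α.s = β.r) : Mor C :=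
  ⟨β.s, α.r, β.hom ≫ eqToHom h.symm ≫ α.hom⟩

@[simp] theorem Mor.id_s (x : C) : (Mor.id x).s = x := rfl
@[simp] theorem Mor.id_r (x : C) : (Mor.id x).r = x := rfl
@[simp] theorem Mor.comp_s (α β : Mor C) (h) : (α.comp β h).s = β.s := rfl
@[simp] theorem Mor.comp_r (α β : Mor C) (h) : (α.comp β h).r = α.r := rfl

theorem Mor.comp_assoc (α β γ : Mor C) (h : α.s = β.r) (h' : β.s = γ.r) :
    (α.comp β h).comp γ h' = α.comp (β.comp γ h') h := by
  obtain ⟨a, b, f⟩ := α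
  obtain ⟨c, e, g⟩ := β
  obtain ⟨k, l, m⟩ := γ
  dsimp at h h'
  subst h h'
  change Mor.mk _ _ (m ≫ 𝟙 c ≫ g ≫ 𝟙 a ≫ f) = Mor.mk _ _ ((m ≫ 𝟙 c ≫ g) ≫ 𝟙 a ≫ f)
  simp

theorem Mor.id_comp (x : C) (α : Mor C) (h : x = α.r) : (Mor.id x).comp α h = α := by
  obtain ⟨a, b, f⟩ := α
  dsimp at h
  subst h
  change Mor.mk _ _ (f ≫ 𝟙 x ≫ 𝟙 x) = _
  simp

theorem Mor.comp_id (α : Mor C) (x : C) (h : α.s = x) : α.comp (Mor.id x) h = α := by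
  obtain ⟨a, b, f⟩ := α
  dsimp at h
  subst h
  simp [Mor.comp, Mor.id]

/-- `α ≤ β`: `α` is an initial segment of `β`. -/
def Mor.Le (α β : Mor C) : Prop := ∃ (γ : Mor C) (h : α.s = γ.r), α.comp γ h = β

theorem Mor.Le.rfl' (α : Mor C) : α.Le α := ⟨Mor.id α.s, rfl, Mor.comp_id _ _ _⟩

theorem Mor.Le.trans' {α β γ : Mor C} (h : α.Le β) (h' : β.Le γ) : α.Le γ := by
  obtain ⟨x, hx, rfl⟩ := h
  obtain ⟨y, hy, rfl⟩ := h'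
  exact ⟨x.comp y hy, hx, (Mor.comp_assoc _ _ _ _ _).symm⟩

/-- The principal right ideal `αΛ`. -/
def Mor.ideal (α : Mor C) : Set (Mor C) := {ξ | ∃ (γ : Mor C) (h : α.s = γ.r), α.comp γ h = ξ}

variable (C) in
/-- The set `Λ⁻¹` of right invertible morphisms. -/
def invertibles : Set (Mor C) := {α | ∃ (β : Mor C) (h : α.s = β.r), α.comp β h = Mor.id β.s}

variable (C) in
/-- `αβ = αγ` implies `β = γ`. -/
class LeftCancellative : Prop where
  cancel : ∀ (α β γ : Mor C) (h : α.s = β.r) (h' : α.s = γ.r),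
    α.comp β h = α.comp γ h' → β = γ

variable (C) in
/-- `αΛ ∩ βΛ` is a finite union of principal right ideals. -/
class FinitelyAligned : Prop where
  aligned : ∀ α β : Mor C, ∃ K : Set (Mor C), K.Finite ∧
    α.ideal ∩ β.ideal = ⋃ γ ∈ K, γ.ideal

variable (C) in
/-- The action of `Λ⁻¹` on `Λ` by left multiplication is free. -/
def ActionFree : Prop :=
  ∀ (g γ : Mor C) (h : g.s = γ.r), g ∈ invertibles C → g.comp γ h = γ → g = Mor.id γ.r

variable (C) in
structure LengthFunction {Q : Type uQ} [Group Q] (Γ : Submonoid Q) where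
  toFun : Mor C → Γ
  map_comp : ∀ (α β : Mor C) (h : α.s = β.r), toFun (α.comp β h) = toFun α * toFun β

/-- The weak factorization property. -/
def LengthFunction.WFP {Q : Type uQ} [Group Q] {Γ : Submonoid Q} (d : LengthFunction C Γ) : Prop :=
  ∀ (α : Mor C) (γ₁ γ₂ : Γ), d.toFun α = γ₁ * γ₂ →
    ∃ (α₁ α₂ : Mor C) (h : α₁.s = α₂.r), d.toFun α₁ = γ₁ ∧ d.toFun α₂ = γ₂ ∧
      α = α₁.comp α₂ h ∧
      ∀ (β₁ β₂ : Mor C) (h' : β₁.s = β₂.r), d.toFun β₁ = γ₁ → d.toFun β₂ = γ₂ →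
        α = β₁.comp β₂ h' →
        ∃ g₁ ∈ invertibles C, ∃ g₂ ∈ invertibles C,
          ∃ (h₁ : α₁.s = g₁.r) (h₂ : g₂.s = α₂.r),
            β₁ = α₁.comp g₁ h₁ ∧ β₂ = g₂.comp α₂ h₂

end SmallCategories

section Groupoids

variable {G : Type u₁} [Groupoid.{v₁} G]

/-- The inverse of a morphism of a groupoid. -/
abbrev Mor.inv (g : Mor G) : Mor G := ⟨g.r, g.s, Groupoid.inv g.hom⟩

@[simp] theorem Mor.inv_s (g : Mor G) : g.inv.s = g.r := rfl
@[simp] theorem Mor.inv_r (g : Mor G) : g.inv.r = g.s := rfl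

theorem Mor.comp_inv (g : Mor G) : g.comp g.inv rfl = Mor.id g.r := by
  simp [Mor.comp, Mor.inv, Mor.id]

theorem Mor.inv_comp (g : Mor G) : g.inv.comp g rfl = Mor.id g.s := by
  simp [Mor.comp, Mor.inv, Mor.id]

/-- A groupoid with a topology on its set of morphisms is a topological groupoid if inversion and
the product on composable pairs are continuous. -/
structure IsTopologicalGroupoid (G : Type u₁) [Groupoid.{v₁} G] [TopologicalSpace (Mor G)] :
    Prop where
  continuous_inv : Continuous (Mor.inv : Mor G → Mor G)
  continuous_comp :
    Continuous (fun p : {p : Mor G × Mor G // p.1.s = p.2.r} => p.1.1.comp p.1.2 p.2)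

end Groupoids

section PartialIsomorphisms

variable {C : Type u} [Category.{v} C]

/-- The set `vΛ` of morphisms with range `v`. -/
def Into (x : C) : Type (max u v) := {α : Mor C // α.r = x}

variable {Q : Type uQ} [Group Q] {Γ : Submonoid Q}

/-- A bijection `f : vΛ → wΛ` with `f(αΛ) = f(α)Λ`, `f(v) = w` and `d(f(α)) = d(α)`. -/
structure PartialIso (d : LengthFunction C Γ) (x y : C) where
  toEquiv : Into x ≃ Into y
  map_ideal : ∀ α : Into x,
    (fun ξ => (toEquiv ξ).1) '' {ξ : Into x | ξ.1 ∈ α.1.ideal} = (toEquiv α).1.ideal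
  map_unit : toEquiv ⟨Mor.id x, rfl⟩ = ⟨Mor.id y, rfl⟩
  map_length : ∀ α : Into x, d.toFun (toEquiv α).1 = d.toFun α.1

theorem PartialIso.ext' {d : LengthFunction C Γ} {x y : C} {f g : PartialIso d x y}
    (h : f.toEquiv = g.toEquiv) : f = g := by
  cases f; cases g; cases h; rfl

def PartialIso.refl (d : LengthFunction C Γ) (x : C) : PartialIso d x x where
  toEquiv := Equiv.refl _
  map_ideal α := by
    ext ξ
    constructor
    · rintro ⟨η, h, rfl⟩
      exact h
    · rintro ⟨γ, h, rfl⟩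
      exact ⟨⟨α.1.comp γ h, α.2⟩, ⟨γ, h, rfl⟩, rfl⟩
  map_unit := rfl
  map_length _ := rfl

def PartialIso.trans {d : LengthFunction C Γ} {x y z : C} (f : PartialIso d x y)
    (g : PartialIso d y z) : PartialIso d x z where
  toEquiv := f.toEquiv.trans g.toEquiv
  map_ideal α := by
    simp only [Equiv.trans_apply]
    rw [← g.map_ideal]
    ext ξ
    constructor
    · rintro ⟨η, h, rfl⟩
      refine ⟨f.toEquiv η, ?_, rfl⟩
      change (f.toEquiv η).1 ∈ (f.toEquiv α).1.ideal
      rw [← f.map_ideal]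
      exact ⟨η, h, rfl⟩
    · rintro ⟨η, h, rfl⟩
      change η.1 ∈ (f.toEquiv α).1.ideal at h
      rw [← f.map_ideal] at h
      obtain ⟨ζ, h1, h2⟩ := h
      have : f.toEquiv ζ = η := Subtype.ext h2
      exact ⟨ζ, h1, by simp [this]⟩
  map_unit := (congrArg g.toEquiv f.map_unit).trans g.map_unit
  map_length α := by simp [f.map_length, g.map_length]

def PartialIso.symm {d : LengthFunction C Γ} {x y : C} (f : PartialIso d x y) :
    PartialIso d y x where
  toEquiv := f.toEquiv.symm
  map_ideal α := by
    have key : ∀ β : Into x, β.1 ∈ (f.toEquiv.symm α).1.ideal ↔ (f.toEquiv β).1 ∈ α.1.ideal := by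
      intro β
      have := f.map_ideal (f.toEquiv.symm α)
      rw [Equiv.apply_symm_apply] at this
      rw [← this]
      constructor
      · intro h
        exact ⟨β, h, rfl⟩
      · rintro ⟨ζ, h1, h2⟩
        have : f.toEquiv ζ = f.toEquiv β := Subtype.ext h2
        rw [← f.toEquiv.injective this]
        exact h1
    ext ξ
    constructor
    · rintro ⟨η, h, rfl⟩
      rw [key]
      simpa using h
    · intro h
      have hr : ξ.r = x := by
        obtain ⟨γ, h', rfl⟩ := h
        exact (f.toEquiv.symm α).2
      exact ⟨f.toEquiv ⟨ξ, hr⟩, (key ⟨ξ, hr⟩).1 h,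
        congrArg Subtype.val (f.toEquiv.symm_apply_apply ⟨ξ, hr⟩)⟩
  map_unit := (Equiv.symm_apply_eq _).2 f.map_unit.symm
  map_length α := by rw [← f.map_length, Equiv.apply_symm_apply]

/-- `PIso(Λ, d)`, the groupoid of partial isomorphisms; its unit space is the set of objects. -/
def PIso (_d : LengthFunction C Γ) : Type u := C

instance (d : LengthFunction C Γ) : Groupoid (PIso d) where
  Hom x y := PartialIso (C := C) d x y
  id x := PartialIso.refl (C := C) d x
  comp f g := PartialIso.trans f g
  inv f := PartialIso.symm f
  id_comp _ := PartialIso.ext' (by ext; rfl)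
  comp_id _ := PartialIso.ext' (by ext; rfl)
  assoc _ _ _ := PartialIso.ext' (by ext; rfl)
  inv_comp f := PartialIso.ext' (Equiv.symm_trans_self f.toEquiv)
  comp_inv f := PartialIso.ext' (Equiv.self_trans_symm f.toEquiv)

/-- An action of a (discrete) groupoid `G` on `C`: a groupoid homomorphism to `PIso(Λ, d)` that is
bijective on unit spaces. -/
structure GroupoidAction (d : LengthFunction C Γ) (G : Type u₁) [Groupoid.{v₁} G] where
  toFunctor : G ⥤ PIso d
  bijective_obj : Function.Bijective toFunctor.obj

variable {d : LengthFunction C Γ} {G : Type u₁} [Groupoid.{v₁} G]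

/-- The bijection from the units of `G` to the objects of `C`. -/
def GroupoidAction.obj (A : GroupoidAction d G) (w : G) : C := A.toFunctor.obj w

/-- `g · α`, for `s(g) = r(α)`. -/
def GroupoidAction.act (A : GroupoidAction d G) (g : Mor G) (α : Mor C) (h : A.obj g.s = α.r) :
    Mor C :=
  (PartialIso.toEquiv (A.toFunctor.map g.hom) ⟨α, h.symm⟩).1

theorem GroupoidAction.act_r (A : GroupoidAction d G) (g : Mor G) (α : Mor C) (h) :
    (A.act g α h).r = A.obj g.r :=
  (PartialIso.toEquiv (A.toFunctor.map g.hom) ⟨α, h.symm⟩).2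

theorem GroupoidAction.act_comp (A : GroupoidAction d G) (g k : Mor G) (h' : g.s = k.r)
    (α : Mor C) (h : A.obj k.s = α.r) :
    A.act (g.comp k h') α h =
      A.act g (A.act k α h) ((congrArg A.obj h').trans (A.act_r k α h).symm) := by
  obtain ⟨a, b, f⟩ := g
  obtain ⟨c, e, g⟩ := k
  dsimp at h'
  subst h'
  simp only [Mor.comp, GroupoidAction.act, eqToHom_refl, Category.id_comp, Functor.map_comp]
  rfl

theorem GroupoidAction.act_id (A : GroupoidAction d G) (w : G) (α : Mor C) (h : A.obj w = α.r) :
    A.act (Mor.id w) α h = α := by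
  have e := A.toFunctor.map_id w
  change (PartialIso.toEquiv (A.toFunctor.map (𝟙 w)) ⟨α, h.symm⟩).1 = α
  rw [e]
  rfl

theorem GroupoidAction.act_unit (A : GroupoidAction d G) (g : Mor G) :
    A.act g (Mor.id (A.obj g.s)) rfl = Mor.id (A.obj g.r) :=
  congrArg Subtype.val (PartialIso.map_unit (A.toFunctor.map g.hom))

theorem GroupoidAction.act_injective (A : GroupoidAction d G) (g : Mor G) (α β : Mor C) (h h')
    (e : A.act g α h = A.act g β h') : α = β := by
  have := (PartialIso.toEquiv (A.toFunctor.map g.hom)).injective (Subtype.ext e)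
  exact congrArg Subtype.val this

/-- A category cocycle for the action `A`. The condition
`s(g·α) = φ(g,α)·s(α) = r(φ(g,α))`, is split into `map_s` (which says that `φ(g,α)·s(α)` is defined;
it then equals `r(φ(g,α))`, see `GroupoidAction.act_unit`) and `map_r`. -/
structure CategoryCocycle (A : GroupoidAction d G) where
  toFun : (g : Mor G) → (α : Mor C) → A.obj g.s = α.r → Mor G
  map_s : ∀ g α h, A.obj (toFun g α h).s = α.s
  map_r : ∀ g α h, A.obj (toFun g α h).r = (A.act g α h).s
  /-- `φ(gk, α) = φ(g, k·α) φ(k, α)` -/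
  cocycle : ∀ (g k : Mor G) (hgk : g.s = k.r) (α : Mor C) (h : A.obj k.s = α.r),
    toFun (g.comp k hgk) α h =
      (toFun g (A.act k α h) ((congrArg A.obj hgk).trans (A.act_r k α h).symm)).comp
        (toFun k α h) (A.bijective_obj.1 ((map_s _ _ _).trans (map_r _ _ _).symm))
  /-- `φ(g, d(g)) = g` -/
  map_unit : ∀ g : Mor G, toFun g (Mor.id (A.obj g.s)) rfl = g
  /-- `φ(r(α), α) = s(α)` -/
  unit_map : ∀ (w w' : G) (α : Mor C) (h : A.obj w = α.r), A.obj w' = α.s →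
    toFun (Mor.id w) α h = Mor.id w'
  /-- `φ(g, αβ) = φ(φ(g, α), β)` -/
  map_comp : ∀ (g : Mor G) (α β : Mor C) (h : A.obj g.s = α.r) (h' : α.s = β.r),
    toFun g (α.comp β h') h = toFun (toFun g α h) β ((map_s _ _ _).trans h')
  /-- `g·(αβ) = (g·α)(φ(g, α)·β)` -/
  act_comp : ∀ (g : Mor G) (α β : Mor C) (h : A.obj g.s = α.r) (h' : α.s = β.r),
    A.act g (α.comp β h') h =
      (A.act g α h).comp (A.act (toFun g α h) β ((map_s _ _ _).trans h'))
        ((map_r _ _ _).symm.trans (A.act_r _ _ _).symm)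

/-- The category system is pseudo-free: `Λ` is action-free, and `g·α = fα`, `φ(g, α) = s(α)` with
`f ∈ Λ⁻¹` imply that `g` is a unit. -/
def CategoryCocycle.PseudoFree {A : GroupoidAction d G} (φ : CategoryCocycle A) : Prop :=
  ActionFree C ∧
  ∀ (g : Mor G) (α f : Mor C) (h : A.obj g.s = α.r) (hf : f.s = α.r), f ∈ invertibles C →
    A.act g α h = f.comp α hf →
    (∃ w : G, A.obj w = α.s ∧ φ.toFun g α h = Mor.id w) →
    ∃ w : G, g = Mor.id w

end PartialIsomorphisms

section TightGroupoid

variable {C : Type u} [Category.{v} C]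

/-- Hereditary: closed under passing to initial segments. -/
def IsHereditary (F : Set (Mor C)) : Prop := ∀ α β : Mor C, β ∈ F → α.Le β → α ∈ F

/-- (Upwards) directed. -/
def IsDirected' (F : Set (Mor C)) : Prop := ∀ α ∈ F, ∀ β ∈ F, ∃ γ ∈ F, α.Le γ ∧ β.Le γ

/-- The elements of `Λ*`: nonempty, hereditary and directed sets. -/
structure IsFilter (F : Set (Mor C)) : Prop where
  nonempty : F.Nonempty
  hereditary : IsHereditary F
  directed : IsDirected' F

/-- The elements of `Λ**`: the maximal elements of `Λ*`. -/
def IsMaximalFilter (F : Set (Mor C)) : Prop :=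
  IsFilter F ∧ ∀ D : Set (Mor C), IsFilter D → F ⊆ D → D = F

/-- Tight hereditary directed sets. -/
def IsTight (F : Set (Mor C)) : Prop :=
  IsFilter F ∧ ∀ α ∈ F, ∀ K : Set (Mor C), K.Finite → F ∩ K = ∅ →
    ∃ D : Set (Mor C), IsMaximalFilter D ∧ α ∈ D ∧ D ∩ K = ∅

variable (C) in
/-- The space `Λ_tight` of tight hereditary directed sets. -/
structure Tight where
  carrier : Set (Mor C)
  isTight : IsTight carrier

theorem Tight.ext' {F F' : Tight C} (h : F.carrier = F'.carrier) : F = F' := by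
  cases F; cases F'; cases h; rfl

/-- The topology with subbasis the sets `{F | α ∈ F}` and `{F | α ∉ F}`; that is, the topology of
pointwise convergence of indicator functions. -/
instance : TopologicalSpace (Tight C) := TopologicalSpace.generateFrom
  ({U | ∃ α : Mor C, U = {F | α ∈ F.carrier}} ∪ {U | ∃ α : Mor C, U = {F | α ∉ F.carrier}})

variable [LeftCancellative C]

open Classical in
/-- The partial bijection `τ^α : s(α)Λ → αΛ`, `β ↦ αβ`. Its inverse is `σ^α : αβ ↦ β`. -/
noncomputable def tau (α : Mor C) : Mor C ≃. Mor C where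
  toFun β := if h : α.s = β.r then some (α.comp β h) else none
  invFun ξ := if h : ∃ β : Mor C, ∃ h : α.s = β.r, α.comp β h = ξ then some h.choose else none
  inv β ξ := by
    simp only [Option.dite_none_right_eq_some, Option.some.injEq]
    constructor
    · rintro ⟨h, rfl⟩
      exact h.choose_spec
    · rintro ⟨h, rfl⟩
      have hx : ∃ γ : Mor C, ∃ h' : α.s = γ.r, α.comp γ h' = α.comp β h := ⟨β, h, rfl⟩
      exact ⟨hx, LeftCancellative.cancel _ _ _ _ _ hx.choose_spec.choose_spec⟩

/-- The partial bijection `σ^α : αΛ → s(α)Λ`, `αβ ↦ β`. -/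
noncomputable def sigma (α : Mor C) : Mor C ≃. Mor C := (tau α).symm

theorem mem_tau {α β ξ : Mor C} : ξ ∈ tau α β ↔ ∃ h : α.s = β.r, α.comp β h = ξ := by
  classical
  change (if h : α.s = β.r then some (α.comp β h) else none) = some ξ ↔ _
  simp

theorem mem_sigma {α β ξ : Mor C} : ξ ∈ sigma α β ↔ ∃ h : α.s = ξ.r, α.comp ξ h = β := by
  rw [sigma, PEquiv.mem_iff_mem, mem_tau]

/-- Membership in `S_Λ`, the semigroup of partial bijections of `Λ` (under composition) generated by
all `τ^α` and `σ^α`. -/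
inductive InS : (Mor C ≃. Mor C) → Prop
  | tau (α : Mor C) : InS (tau α)
  | sigma (α : Mor C) : InS (sigma α)
  | comp {s t : Mor C ≃. Mor C} : InS s → InS t → InS (t.trans s)

variable (C) in
/-- The inverse semigroup `S_Λ`. -/
structure SL where
  val : Mor C ≃. Mor C
  prop : InS val

theorem SL.ext' {s t : SL C} (h : s.val = t.val) : s = t := by
  cases s; cases t; cases h; rfl

/-- The product `st = s ∘ t`. -/
instance : Mul (SL C) := ⟨fun s t => ⟨t.val.trans s.val, InS.comp s.prop t.prop⟩⟩

theorem InS.symm {f : Mor C ≃. Mor C} (h : InS f) : InS f.symm := by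
  induction h with
  | tau α => exact InS.sigma α
  | sigma α => exact InS.tau α
  | comp _ _ h1 h2 => exact InS.comp h2 h1

/-- The involution `s ↦ s*`. -/
def SL.star (s : SL C) : SL C := ⟨s.val.symm, s.prop.symm⟩

/-- The domain of a partial bijection. -/
def SL.dom (s : SL C) : Set (Mor C) := {γ | ∃ η, η ∈ s.val γ}

theorem SL.mem_mul {s t : SL C} {γ η : Mor C} :
    η ∈ (s * t).val γ ↔ ∃ ζ, ζ ∈ t.val γ ∧ η ∈ s.val ζ := PEquiv.mem_trans _ _ _ _

theorem SL.mem_star {s : SL C} {γ η : Mor C} : η ∈ s.star.val γ ↔ γ ∈ s.val η :=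
  PEquiv.mem_iff_mem _

theorem SL.star_star (s : SL C) : s.star.star = s := SL.ext' s.val.symm_symm

theorem SL.unique {s : SL C} {γ η η' : Mor C} (h : η ∈ s.val γ) (h' : η' ∈ s.val γ) : η = η' :=
  Option.mem_unique h h'

theorem SL.inj {s : SL C} {γ γ' η : Mor C} (h : η ∈ s.val γ) (h' : η ∈ s.val γ') : γ = γ' :=
  s.val.inj h h'

theorem SL.right_mul (s : SL C) {γ η β : Mor C} (h : η ∈ s.val γ) (hβ : γ.s = β.r) :
    ∃ h' : η.s = β.r, η.comp β h' ∈ s.val (γ.comp β hβ) := by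
  obtain ⟨s, hs⟩ := s
  change η ∈ s γ at h
  change ∃ h' : η.s = β.r, η.comp β h' ∈ s (γ.comp β hβ)
  induction hs generalizing γ η with
  | tau α =>
    obtain ⟨h1, rfl⟩ := mem_tau.1 h
    exact ⟨hβ, mem_tau.2 ⟨h1, (Mor.comp_assoc _ _ _ _ _).symm⟩⟩
  | sigma α =>
    obtain ⟨h1, rfl⟩ := mem_sigma.1 h
    exact ⟨hβ, mem_sigma.2 ⟨h1, (Mor.comp_assoc _ _ _ _ _).symm⟩⟩
  | comp _ _ ih1 ih2 =>
    obtain ⟨ζ, h1, h2⟩ := (PEquiv.mem_trans _ _ _ _).1 h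
    obtain ⟨e1, h3⟩ := ih2 hβ h1
    obtain ⟨e2, h4⟩ := ih1 e1 h2
    exact ⟨e2, (PEquiv.mem_trans _ _ _ _).2 ⟨_, h3, h4⟩⟩

theorem SL.mono (s : SL C) {γ γ' η : Mor C} (h : η ∈ s.val γ) (hle : γ.Le γ') :
    ∃ η', η' ∈ s.val γ' ∧ η.Le η' := by
  obtain ⟨β, hβ, rfl⟩ := hle
  obtain ⟨h1, h2⟩ := s.right_mul h hβ
  exact ⟨_, h2, β, h1, rfl⟩

/-- `s · F = ⋃ [s(γ)]` over `γ ∈ F ∩ dom(s)`. -/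
def SL.act (s : SL C) (F : Set (Mor C)) : Set (Mor C) :=
  {δ | ∃ γ ∈ F, ∃ η ∈ s.val γ, δ.Le η}

theorem SL.act_mem {s : SL C} {F : Set (Mor C)} {γ η : Mor C} (hγ : γ ∈ F) (h : η ∈ s.val γ) :
    η ∈ s.act F := ⟨γ, hγ, η, h, Mor.Le.rfl' η⟩

theorem SL.act_mono {s : SL C} {F F' : Set (Mor C)} (h : F ⊆ F') : s.act F ⊆ s.act F' :=
  fun _ ⟨γ, hγ, H⟩ => ⟨γ, h hγ, H⟩

theorem IsFilter.act {s : SL C} {F : Set (Mor C)} (hF : IsFilter F)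
    (h : (F ∩ s.dom).Nonempty) : IsFilter (s.act F) where
  nonempty := by
    obtain ⟨γ, hγ, η, hη⟩ := h
    exact ⟨η, SL.act_mem hγ hη⟩
  hereditary := by
    rintro α β ⟨γ, hγ, η, hη, hle⟩ h'
    exact ⟨γ, hγ, η, hη, h'.trans' hle⟩
  directed := by
    rintro α ⟨γ, hγ, η, hη, hle⟩ β ⟨γ', hγ', η', hη', hle'⟩
    obtain ⟨ζ, hζ, h1, h2⟩ := hF.directed γ hγ γ' hγ'
    obtain ⟨ξ, h3, h4⟩ := s.mono hη h1
    obtain ⟨ξ', h5, h6⟩ := s.mono hη' h2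
    obtain rfl := SL.unique h3 h5
    exact ⟨ξ, SL.act_mem hζ h3, hle.trans' h4, hle'.trans' h6⟩

theorem SL.star_act {s : SL C} {F : Set (Mor C)} (hF : IsFilter F) (h : (F ∩ s.dom).Nonempty) :
    s.star.act (s.act F) = F := by
  ext δ
  constructor
  · rintro ⟨ξ, ⟨γ, hγ, η, hη, hle⟩, ζ, hζ, hle'⟩
    rw [SL.mem_star] at hζ
    obtain ⟨γ', h1, h2⟩ := s.star.mono (SL.mem_star.2 hζ) hle
    obtain rfl := SL.unique h1 (SL.mem_star.2 hη)
    exact hF.hereditary _ _ hγ (hle'.trans' h2)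
  · intro hδ
    obtain ⟨γ, hγ, η, hη⟩ := h
    obtain ⟨ζ, hζ, h1, h2⟩ := hF.directed δ hδ γ hγ
    obtain ⟨ξ, h3, h4⟩ := s.mono hη h2
    exact ⟨ξ, SL.act_mem hζ h3, ζ, SL.mem_star.2 h3, h1⟩

theorem SL.act_dom_star {s : SL C} {F : Set (Mor C)} (h : (F ∩ s.dom).Nonempty) :
    (s.act F ∩ s.star.dom).Nonempty := by
  obtain ⟨γ, hγ, η, hη⟩ := h
  exact ⟨η, SL.act_mem hγ hη, γ, SL.mem_star.2 hη⟩

theorem SL.act_star {s : SL C} {F : Set (Mor C)} (hF : IsFilter F)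
    (h : (F ∩ s.star.dom).Nonempty) : s.act (s.star.act F) = F := by
  have := SL.star_act hF h
  rwa [SL.star_star] at this

theorem IsMaximalFilter.act {s : SL C} {F : Set (Mor C)} (hF : IsMaximalFilter F)
    (h : (F ∩ s.dom).Nonempty) : IsMaximalFilter (s.act F) := by
  refine ⟨hF.1.act h, fun D hD hsub => ?_⟩
  have hd : (D ∩ s.star.dom).Nonempty :=
    (SL.act_dom_star h).mono (Set.inter_subset_inter_left _ hsub)
  have h1 : F ⊆ s.star.act D := by
    rw [← SL.star_act hF.1 h]
    exact SL.act_mono hsub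
  have h2 := hF.2 _ (hD.act hd) h1
  rw [← h2, SL.act_star hD hd]

theorem IsTight.act [FinitelyAligned C] {s : SL C} {F : Set (Mor C)} (hF : IsTight F)
    (h : (F ∩ s.dom).Nonempty) : IsTight (s.act F) := by
  refine ⟨hF.1.act h, ?_⟩
  rintro α ⟨γ, hγ, η, hη, hle⟩ K hK hdis
  choose J hJ hJ' using fun k : Mor C => FinitelyAligned.aligned η k
  let K' : Set (Mor C) := {ζ | ∃ k ∈ K, ∃ ε ∈ J k, ζ ∈ s.star.val ε}
  have hK' : K'.Finite := by
    have : K' = ⋃ k ∈ K, ⋃ ε ∈ J k, {ζ | ζ ∈ s.star.val ε} := by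
      ext ζ
      simp [K']
    rw [this]
    refine hK.biUnion fun k _ => (hJ k).biUnion fun ε _ => ?_
    exact Set.Subsingleton.finite fun x hx y hy => SL.unique hx hy
  have hdis' : F ∩ K' = ∅ := by
    rw [Set.eq_empty_iff_forall_notMem]
    rintro ζ ⟨hζ, k, hk, ε, hε, hm⟩
    have h1 : ε ∈ s.act F := SL.act_mem hζ (SL.mem_star.1 hm)
    have h2 : ε ∈ η.ideal ∩ k.ideal := by
      rw [hJ' k]
      exact Set.mem_biUnion hε (Mor.Le.rfl' ε)
    have h3 : k ∈ s.act F := (hF.1.act h).hereditary _ _ h1 h2.2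
    exact (Set.eq_empty_iff_forall_notMem.1 hdis) k ⟨h3, hk⟩
  obtain ⟨D, hD, hγD, hDK⟩ := hF.2 γ hγ K' hK' hdis'
  have hDd : (D ∩ s.dom).Nonempty := ⟨γ, hγD, η, hη⟩
  refine ⟨s.act D, hD.act hDd, ⟨γ, hγD, η, hη, hle⟩, ?_⟩
  rw [Set.eq_empty_iff_forall_notMem]
  rintro k ⟨hk, hkK⟩
  obtain ⟨ξ, hξ, h1, h2⟩ := (hD.1.act hDd).directed η (SL.act_mem hγD hη) k hk
  have h3 : ξ ∈ η.ideal ∩ k.ideal := ⟨h1, h2⟩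
  rw [hJ' k] at h3
  obtain ⟨ε, hε, h4⟩ := Set.mem_iUnion₂.1 h3
  have h5 : ε ∈ η.ideal ∩ k.ideal := by
    rw [hJ' k]
    exact Set.mem_biUnion hε (Mor.Le.rfl' ε)
  have h6 : ε ∈ s.act D := (hD.1.act hDd).hereditary _ _ hξ h4
  obtain ⟨ζ, hζ, -⟩ := s.star.mono (SL.mem_star.2 hη) h5.1
  have h7 : ζ ∈ D := by
    rw [← SL.star_act hD.1 hDd]
    exact SL.act_mem h6 hζ
  exact (Set.eq_empty_iff_forall_notMem.1 hDK) ζ ⟨h7, k, hkK, ε, hε, hζ⟩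

/-- The pairs `(s, F)` with `F ∩ dom(s) ≠ ∅` and `s · F = F'`. -/
structure Rep (F F' : Tight C) where
  elt : SL C
  meets : (F.carrier ∩ elt.dom).Nonempty
  act_eq : elt.act F.carrier = F'.carrier

/-- `(s, F) ∼ (t, F)`: there is an idempotent `e ∈ S_Λ` with `F ∩ dom(e) ≠ ∅` and `se = te`. -/
def GermRel (F : Tight C) (s t : SL C) : Prop :=
  ∃ e : SL C, e * e = e ∧ (F.carrier ∩ e.dom).Nonempty ∧ s * e = t * e

theorem GermRel.iff {F : Tight C} {s t : SL C} (hs : (F.carrier ∩ s.dom).Nonempty) :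
    GermRel F s t ↔ ∃ γ ∈ F.carrier, ∃ η, η ∈ s.val γ ∧ η ∈ t.val γ := by
  constructor
  · rintro ⟨e, he, ⟨γ, hγ, η, hη⟩, hst⟩
    obtain ⟨γ', hγ', η', hη'⟩ := hs
    obtain ⟨ζ, hζ, h1, h2⟩ := F.isTight.1.directed γ hγ γ' hγ'
    obtain ⟨ξ, hξ, -⟩ := e.mono hη h1
    obtain ⟨ξ', hξ', -⟩ := s.mono hη' h2
    have hξζ : ξ = ζ := by
      have h3 := hξ
      rw [← he, SL.mem_mul] at h3
      obtain ⟨x, hx, hx'⟩ := h3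
      obtain rfl := SL.unique hx hξ
      exact SL.inj hx' hξ
    subst hξζ
    refine ⟨ξ, hζ, ξ', hξ', ?_⟩
    have h4 : ξ' ∈ (s * e).val ξ := SL.mem_mul.2 ⟨ξ, hξ, hξ'⟩
    rw [hst, SL.mem_mul] at h4
    obtain ⟨x, hx, hx'⟩ := h4
    obtain rfl := SL.unique hx hξ
    exact hx'
  · rintro ⟨γ, hγ, η, h1, h2⟩
    let e : SL C := ⟨(sigma γ).trans (tau γ), InS.comp (InS.tau γ) (InS.sigma γ)⟩
    have he : ∀ x y, y ∈ e.val x ↔ x = y ∧ γ.Le x := by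
      intro x y
      change y ∈ (sigma γ).trans (tau γ) x ↔ _
      rw [PEquiv.mem_trans]
      constructor
      · rintro ⟨b, hb, hb'⟩
        obtain ⟨h, rfl⟩ := mem_sigma.1 hb
        obtain ⟨h', rfl⟩ := mem_tau.1 hb'
        exact ⟨rfl, b, h, rfl⟩
      · rintro ⟨rfl, b, h, rfl⟩
        exact ⟨b, mem_sigma.2 ⟨h, rfl⟩, mem_tau.2 ⟨h, rfl⟩⟩
    refine ⟨e, ?_, ⟨γ, hγ, γ, (he _ _).2 ⟨rfl, Mor.Le.rfl' γ⟩⟩, ?_⟩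
    · refine SL.ext' (PEquiv.ext fun x => Option.ext fun y => ?_)
      change y ∈ (e * e).val x ↔ y ∈ e.val x
      rw [SL.mem_mul, he]
      constructor
      · rintro ⟨z, hz, hz'⟩
        obtain ⟨rfl, hz⟩ := (he _ _).1 hz
        exact (he _ _).1 hz'
      · rintro ⟨rfl, h⟩
        exact ⟨x, (he _ _).2 ⟨rfl, h⟩, (he _ _).2 ⟨rfl, h⟩⟩
    · have key : ∀ (a b : SL C), η ∈ a.val γ → η ∈ b.val γ → ∀ x y, y ∈ (a * e).val x →
          y ∈ (b * e).val x := by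
        intro a b ha hb x y hy
        obtain ⟨z, hz, hz'⟩ := SL.mem_mul.1 hy
        obtain ⟨rfl, β, hβ, rfl⟩ := (he _ _).1 hz
        refine SL.mem_mul.2 ⟨_, hz, ?_⟩
        obtain ⟨h3, h4⟩ := a.right_mul ha hβ
        obtain ⟨h5, h6⟩ := b.right_mul hb hβ
        obtain rfl := SL.unique hz' h4
        exact h6
      refine SL.ext' (PEquiv.ext fun x => Option.ext fun y => ?_)
      exact ⟨key s t h1 h2 x y, key t s h2 h1 x y⟩

theorem Rep.rel_iff {F F' : Tight C} (s t : Rep F F') :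
    GermRel F s.elt t.elt ↔ ∃ γ ∈ F.carrier, ∃ η, η ∈ s.elt.val γ ∧ η ∈ t.elt.val γ :=
  GermRel.iff s.meets

instance germSetoid (F F' : Tight C) : Setoid (Rep F F') where
  r s t := GermRel F s.elt t.elt
  iseqv :=
    { refl := fun s => by
        obtain ⟨γ, hγ, η, hη⟩ := s.meets
        exact (s.rel_iff s).2 ⟨γ, hγ, η, hη, hη⟩
      symm := fun {_ _} ⟨e, h1, h2, h3⟩ => ⟨e, h1, h2, h3.symm⟩
      trans := fun {s t w} h h' => by
        obtain ⟨γ, hγ, η, h1, h2⟩ := (s.rel_iff t).1 h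
        obtain ⟨γ', hγ', η', h1', h2'⟩ := (t.rel_iff w).1 h'
        obtain ⟨ζ, hζ, h3, h4⟩ := F.isTight.1.directed γ hγ γ' hγ'
        obtain ⟨a, ha, -⟩ := s.elt.mono h1 h3
        obtain ⟨β, hβ, rfl⟩ := h3
        obtain ⟨β', hβ', e⟩ := h4
        refine (s.rel_iff w).2 ⟨_, hζ, η.comp β (s.elt.right_mul h1 hβ).1,
          (s.elt.right_mul h1 hβ).2, ?_⟩
        have h5 := (t.elt.right_mul h2 hβ).2
        have h6 := t.elt.right_mul h1' hβ'
        have h7 := w.elt.right_mul h2' hβ'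
        obtain ⟨h6a, h6⟩ := h6
        obtain ⟨h7a, h7⟩ := h7
        rw [e] at h6 h7
        rw [SL.unique h5 h6]
        exact h7 }

/-- The germs `[s, F]` with source `F` and range `s · F = F'`. -/
def Germ (F F' : Tight C) := Quotient (germSetoid F F')

/-- `(s, F) (t, F₀) = (st, F₀)`, where `F = t · F₀`. -/
def Rep.mul {F₀ F F' : Tight C} (s : Rep F F') (t : Rep F₀ F) : Rep F₀ F' where
  elt := s.elt * t.elt
  meets := by
    obtain ⟨γ, hγ, η, hη⟩ := s.meets
    rw [← t.act_eq] at hγ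
    obtain ⟨ζ, hζ, ξ, hξ, hle⟩ := hγ
    obtain ⟨x, hx, -⟩ := s.elt.mono hη hle
    exact ⟨ζ, hζ, x, SL.mem_mul.2 ⟨ξ, hξ, hx⟩⟩
  act_eq := by
    rw [← s.act_eq, ← t.act_eq]
    ext δ
    constructor
    · rintro ⟨γ, hγ, η, hη, hle⟩
      obtain ⟨ζ, hζ, hζ'⟩ := SL.mem_mul.1 hη
      exact ⟨ζ, SL.act_mem hγ hζ, η, hζ', hle⟩
    · rintro ⟨ζ, ⟨γ, hγ, ξ, hξ, hle⟩, η, hη, hle'⟩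
      obtain ⟨x, hx, hx'⟩ := s.elt.mono hη hle
      exact ⟨γ, hγ, x, SL.mem_mul.2 ⟨ξ, hξ, hx⟩, hle'.trans' hx'⟩

/-- `(s, F)⁻¹ = (s*, s · F)`. -/
def Rep.inv {F F' : Tight C} (s : Rep F F') : Rep F' F where
  elt := s.elt.star
  meets := by
    rw [← s.act_eq]
    exact SL.act_dom_star s.meets
  act_eq := by
    rw [← s.act_eq]
    exact SL.star_act F.isTight.1 s.meets

/-- A representative `(τ^v, F)` of the unit at `F`, where `v` is the common range of the elements
of `F`; note that `τ^v` is the identity of `vΛ`. -/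
noncomputable def Rep.one (F : Tight C) : Rep F F where
  elt := ⟨tau (Mor.id F.isTight.1.nonempty.some.r), InS.tau _⟩
  meets := ⟨_, F.isTight.1.nonempty.some_mem, _, mem_tau.2 ⟨rfl, rfl⟩⟩
  act_eq := by
    ext δ
    constructor
    · rintro ⟨γ, hγ, η, hη, hle⟩
      obtain ⟨h, rfl⟩ := mem_tau.1 hη
      have e : (Mor.id F.isTight.1.nonempty.some.r).comp γ h = γ := Mor.id_comp _ _ h
      exact F.isTight.1.hereditary _ _ hγ (e ▸ hle)
    · intro hδ
      obtain ⟨ζ, hζ, ⟨β, hβ, h1⟩, h2⟩ := F.isTight.1.directed _ F.isTight.1.nonempty.some_mem δ hδ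
      have hr : F.isTight.1.nonempty.some.r = ζ.r := by rw [← h1]
      exact ⟨ζ, hζ, ζ, mem_tau.2 ⟨hr, Mor.id_comp _ _ hr⟩, h2⟩

theorem Rep.one_mem (F : Tight C) {γ : Mor C} (hγ : γ ∈ F.carrier) :
    γ ∈ (Rep.one F).elt.val γ := by
  obtain ⟨ζ, hζ, ⟨β, hβ, h1⟩, ⟨β', hβ', h2⟩⟩ :=
    F.isTight.1.directed _ F.isTight.1.nonempty.some_mem γ hγ
  have hr : F.isTight.1.nonempty.some.r = γ.r := by
    have := congrArg Mor.r (h1.trans h2.symm)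
    exact this
  exact mem_tau.2 ⟨hr, Mor.id_comp _ _ hr⟩

theorem Rep.image_mem {F F' : Tight C} (s : Rep F F') {γ η : Mor C} (hγ : γ ∈ F.carrier)
    (h : η ∈ s.elt.val γ) : η ∈ F'.carrier := by
  rw [← s.act_eq]
  exact SL.act_mem hγ h

theorem Rep.sound {F F' : Tight C} {s t : Rep F F'}
    (h : ∃ γ ∈ F.carrier, ∃ η, η ∈ s.elt.val γ ∧ η ∈ t.elt.val γ) :
    (Quotient.mk _ s : Germ F F') = Quotient.mk _ t :=
  Quotient.sound ((s.rel_iff t).2 h)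

def Germ.mul {F₀ F F' : Tight C} (s : Germ F F') (t : Germ F₀ F) : Germ F₀ F' :=
  Quotient.map₂ Rep.mul (by
    intro s s' hs t t' ht
    obtain ⟨γ, hγ, η, h1, h2⟩ := (s.rel_iff s').1 hs
    obtain ⟨ζ, hζ, ξ, h3, h4⟩ := (t.rel_iff t').1 ht
    have hγ' := hγ
    rw [← t.act_eq] at hγ'
    obtain ⟨x, hx, y, hy, hle⟩ := hγ'
    obtain ⟨z, hz, ⟨β, hβ, e1⟩, ⟨β', hβ', e2⟩⟩ := F₀.isTight.1.directed x hx ζ hζ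
    obtain ⟨a, ha⟩ := t.elt.right_mul h3 hβ'
    obtain ⟨_, ha'⟩ := t'.elt.right_mul h4 hβ'
    rw [e2] at ha ha'
    obtain ⟨b, hb⟩ := t.elt.right_mul hy hβ
    rw [e1] at hb
    have e3 := SL.unique ha hb
    obtain ⟨k, hk, e4⟩ := hle.trans' ⟨β, b, rfl⟩
    obtain ⟨c, hc⟩ := s.elt.right_mul h1 hk
    obtain ⟨_, hc'⟩ := s'.elt.right_mul h2 hk
    rw [e4, ← e3] at hc hc'
    exact ((s.mul t).rel_iff (s'.mul t')).2
      ⟨z, hz, _, SL.mem_mul.2 ⟨_, ha, hc⟩, SL.mem_mul.2 ⟨_, ha', hc'⟩⟩) s t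

def Germ.inv {F F' : Tight C} (s : Germ F F') : Germ F' F :=
  Quotient.map Rep.inv (by
    intro s t h
    obtain ⟨γ, hγ, η, h1, h2⟩ := (s.rel_iff t).1 h
    exact (s.inv.rel_iff t.inv).2
      ⟨η, s.image_mem hγ h1, γ, SL.mem_star.2 h1, SL.mem_star.2 h2⟩) s

/-- The tight groupoid, with unit space `Λ_tight`; its set of morphisms is
`𝒢_tight(Λ) = Mor (Tight C)`. -/
noncomputable instance : Groupoid (Tight C) where
  Hom F F' := Germ F F'
  id F := Quotient.mk _ (Rep.one F)
  comp t s := Germ.mul s t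
  inv s := Germ.inv s
  id_comp {F F'} s := by
    induction s using Quotient.ind with | _ s
    obtain ⟨γ, hγ, η, hη⟩ := s.meets
    exact Rep.sound ⟨γ, hγ, η, SL.mem_mul.2 ⟨γ, Rep.one_mem F hγ, hη⟩, hη⟩
  comp_id {F F'} s := by
    induction s using Quotient.ind with | _ s
    obtain ⟨γ, hγ, η, hη⟩ := s.meets
    exact Rep.sound ⟨γ, hγ, η, SL.mem_mul.2 ⟨η, hη, Rep.one_mem F' (s.image_mem hγ hη)⟩, hη⟩
  assoc {F₀ F₁ F₂ F₃} a b c := by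
    induction a using Quotient.ind with | _ a
    induction b using Quotient.ind with | _ b
    induction c using Quotient.ind with | _ c
    obtain ⟨γ, hγ, η, hη⟩ := (c.mul (b.mul a)).meets
    refine Rep.sound ⟨γ, hγ, η, hη, ?_⟩
    obtain ⟨x, hx, hx'⟩ := SL.mem_mul.1 hη
    obtain ⟨y, hy, hy'⟩ := SL.mem_mul.1 hx
    exact SL.mem_mul.2 ⟨y, hy, SL.mem_mul.2 ⟨x, hy', hx'⟩⟩
  inv_comp {F F'} s := by
    induction s using Quotient.ind with | _ s
    obtain ⟨γ, hγ, η, hη⟩ := s.inv.meets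
    exact Rep.sound ⟨γ, hγ, γ, SL.mem_mul.2 ⟨η, hη, SL.mem_star.1 hη⟩, Rep.one_mem F' hγ⟩
  comp_inv {F F'} s := by
    induction s using Quotient.ind with | _ s
    obtain ⟨γ, hγ, η, hη⟩ := s.meets
    exact Rep.sound ⟨γ, hγ, γ, SL.mem_mul.2 ⟨η, hη, SL.mem_star.2 hη⟩, Rep.one_mem F hγ⟩

/-- `Θ(s, U) = {[s, F] : F ∈ U, F ∩ dom(s) ≠ ∅}`. -/
def Theta (s : SL C) (U : Set (Tight C)) : Set (Mor (Tight C)) :=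
  {g | g.s ∈ U ∧ ∃ t : Rep g.s g.r, t.elt = s ∧ g.hom = (Quotient.mk _ t : Germ g.s g.r)}

/-- The topology on `𝒢_tight(Λ)` generated by the sets `Θ(s, U)`, for `U` open in `Λ_tight`. -/
instance : TopologicalSpace (Mor (Tight C)) := TopologicalSpace.generateFrom
  {B | ∃ (s : SL C) (U : Set (Tight C)), IsOpen U ∧ B = Theta s U}

end TightGroupoid

section ZappaSzep

variable {C : Type u} [Category.{v} C] {Q : Type uQ} [Group Q] {Γ : Submonoid Q}
  {d : LengthFunction C Γ} {G : Type u₁} [Groupoid.{v₁} G] {A : GroupoidAction d G}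

/-- The objects of the Zappa–Szép product `Λ ⋈ G`: the pair `(u, u)` of matching units of `Λ` and
`G` is recorded as the unit `u` of `G`. -/
def ZS (_φ : CategoryCocycle A) : Type u₁ := G

/-- The morphisms `x ⟶ y` of the Zappa–Szép product: the pairs `(α, g)` with `s(α) = r(g)`, with
range `r(α)` corresponding to `y`, and with source `s(g) = x`. -/
structure ZSHom (A : GroupoidAction d G) (x y : G) where
  fst : Mor C
  snd : Mor G
  match' : fst.s = A.obj snd.r
  fst_r : fst.r = A.obj y
  snd_s : snd.s = x

theorem ZSHom.ext' {x y : G} {p q : ZSHom A x y} (h : p.fst = q.fst) (h' : p.snd = q.snd) :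
    p = q := by
  cases p; cases q; cases h; cases h'; rfl

theorem CategoryCocycle.toFun_congr (φ : CategoryCocycle A) {g g' : Mor G} {α α' : Mor C}
    (hg : g = g') (hα : α = α') (h) : φ.toFun g α h = φ.toFun g' α' (by rw [← hg, ← hα]; exact h) := by
  subst hg hα; rfl

theorem GroupoidAction.act_congr (A : GroupoidAction d G) {g g' : Mor G} {α α' : Mor C}
    (hg : g = g') (hα : α = α') (h) : A.act g α h = A.act g' α' (by rw [← hg, ← hα]; exact h) := by
  subst hg hα; rfl

theorem Mor.comp_congr {D : Type u} [Category.{v} D] {α α' β β' : Mor D}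
    (hα : α = α') (hβ : β = β') (h) : α.comp β h = α'.comp β' (by rw [← hα, ← hβ]; exact h) := by
  subst hα hβ; rfl

/-- `(α, g)(β, h) = (α(g·β), φ(g, β)h)` -/
def ZSHom.mul (φ : CategoryCocycle A) {x y z : G} (p : ZSHom A y z) (q : ZSHom A x y) :
    ZSHom A x z :=
  have hpq : A.obj p.snd.s = q.fst.r := (congrArg A.obj p.snd_s).trans q.fst_r.symm
  { fst := p.fst.comp (A.act p.snd q.fst hpq) (p.match'.trans (A.act_r _ _ _).symm)
    snd := (φ.toFun p.snd q.fst hpq).comp q.snd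
      (A.bijective_obj.1 ((φ.map_s _ _ _).trans q.match'))
    match' := (φ.map_r _ _ _).symm
    fst_r := p.fst_r
    snd_s := q.snd_s }

instance (φ : CategoryCocycle A) : Category (ZS φ) where
  Hom x y := ZSHom (G := G) A x y
  id x := ⟨Mor.id (A.obj x), Mor.id (C := G) x, rfl, rfl, rfl⟩
  comp q p := ZSHom.mul φ p q
  id_comp {x y} p := by
    refine ZSHom.ext' ?_ ?_
    · have hu : A.act p.snd (Mor.id (A.obj x)) (congrArg A.obj p.snd_s) =
          Mor.id (A.obj p.snd.r) := by
        rw [← A.act_unit]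
        exact A.act_congr rfl (by rw [p.snd_s]) _
      exact (Mor.comp_congr rfl hu (p.match'.trans (A.act_r _ _ _).symm)).trans
        (Mor.comp_id _ _ p.match')
    · have h0 : (φ.toFun p.snd (Mor.id (A.obj x)) (congrArg A.obj p.snd_s)).s = x :=
        A.bijective_obj.1 (φ.map_s _ _ _)
      refine (Mor.comp_id (C := G) _ x h0).trans ?_
      exact (φ.toFun_congr rfl (by rw [p.snd_s]) _).trans (φ.map_unit p.snd)
  comp_id {x y} p := by
    refine ZSHom.ext' ?_ ?_
    · have h0 : A.obj y = (A.act (Mor.id (C := G) y) p.fst p.fst_r.symm).r :=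
        (A.act_r (Mor.id (C := G) y) p.fst p.fst_r.symm).symm
      exact (Mor.id_comp _ _ h0).trans (A.act_id y p.fst p.fst_r.symm)
    · have h1 : φ.toFun (Mor.id y) p.fst p.fst_r.symm = Mor.id p.snd.r :=
        φ.unit_map _ _ _ _ p.match'.symm
      have h2 : (φ.toFun (Mor.id y) p.fst p.fst_r.symm).s = p.snd.r := congrArg Mor.s h1
      exact (Mor.comp_congr h1 rfl h2).trans (Mor.id_comp _ _ rfl)
  assoc {x y z t} a b c := by
    -- the product is `(c b) a` on both sides
    have hcb : A.obj c.snd.s = b.fst.r := (congrArg A.obj c.snd_s).trans b.fst_r.symm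
    have hba : A.obj b.snd.s = a.fst.r := (congrArg A.obj b.snd_s).trans a.fst_r.symm
    have hb : b.fst.s = (A.act b.snd a.fst hba).r := b.match'.trans (A.act_r _ _ _).symm
    have hφ : (φ.toFun c.snd b.fst hcb).s = b.snd.r :=
      A.bijective_obj.1 ((φ.map_s _ _ _).trans b.match')
    have hc : ∀ (ξ : Mor C) (h : A.obj c.snd.s = ξ.r), c.fst.s = (A.act c.snd ξ h).r :=
      fun ξ h => c.match'.trans (A.act_r c.snd ξ h).symm
    have k1 : (φ.toFun b.snd a.fst hba).s = a.snd.r :=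
      A.bijective_obj.1 ((φ.map_s _ _ _).trans a.match')
    have k2 : (φ.toFun c.snd (b.fst.comp (A.act b.snd a.fst hba) hb) hcb).s =
        (φ.toFun b.snd a.fst hba).r :=
      A.bijective_obj.1 ((φ.map_s _ _ _).trans (φ.map_r _ _ _).symm)
    have k3 : (φ.toFun ((φ.toFun c.snd b.fst hcb).comp b.snd hφ) a.fst hba).s = a.snd.r :=
      A.bijective_obj.1 ((φ.map_s _ _ _).trans a.match')
    refine ZSHom.ext' ?_ ?_
    · change c.fst.comp (A.act c.snd (b.fst.comp (A.act b.snd a.fst hba) hb) hcb)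
          (hc (b.fst.comp (A.act b.snd a.fst hba) hb) hcb) =
        (c.fst.comp (A.act c.snd b.fst hcb) (hc b.fst hcb)).comp
          (A.act ((φ.toFun c.snd b.fst hcb).comp b.snd hφ) a.fst hba)
          ((φ.map_r c.snd b.fst hcb).symm.trans
            (A.act_r ((φ.toFun c.snd b.fst hcb).comp b.snd hφ) a.fst hba).symm)
      rw [Mor.comp_assoc]
      refine Mor.comp_congr rfl ?_ _
      rw [φ.act_comp]
      refine Mor.comp_congr rfl ?_ _
      rw [A.act_comp]
    · change (φ.toFun c.snd (b.fst.comp (A.act b.snd a.fst hba) hb) hcb).comp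
          ((φ.toFun b.snd a.fst hba).comp a.snd k1) k2 =
        (φ.toFun ((φ.toFun c.snd b.fst hcb).comp b.snd hφ) a.fst hba).comp a.snd k3
      rw [← Mor.comp_assoc]
      · refine Mor.comp_congr ?_ rfl _
        rw [φ.cocycle]
        refine Mor.comp_congr ?_ rfl _
        rw [φ.map_comp]

variable {φ : CategoryCocycle A}

/-- The first component `α` of a morphism `(α, g)` of the Zappa–Szép product. -/
def ZS.fst (a : Mor (ZS φ)) : Mor C := ZSHom.fst a.hom

/-- The second component `g` of a morphism `(α, g)` of the Zappa–Szép product. -/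
def ZS.snd (a : Mor (ZS φ)) : Mor G := ZSHom.snd a.hom

theorem ZS.match' (a : Mor (ZS φ)) : (ZS.fst a).s = A.obj (ZS.snd a).r := ZSHom.match' a.hom

theorem ZS.fst_r (a : Mor (ZS φ)) : (ZS.fst a).r = A.obj a.r := ZSHom.fst_r a.hom

theorem ZS.snd_s (a : Mor (ZS φ)) : (ZS.snd a).s = a.s := ZSHom.snd_s a.hom

theorem ZS.ext {a b : Mor (ZS φ)} (h : ZS.fst a = ZS.fst b) (h' : ZS.snd a = ZS.snd b) :
    a = b := by
  have h1 : a.s = b.s := (ZS.snd_s a).symm.trans ((congrArg Mor.s h').trans (ZS.snd_s b))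
  have h2 : a.r = b.r := A.bijective_obj.1
    ((ZS.fst_r a).symm.trans ((congrArg Mor.r h).trans (ZS.fst_r b)))
  obtain ⟨s, r, p⟩ := a
  obtain ⟨s', r', q⟩ := b
  dsimp at h1 h2
  subst h1 h2
  have : p = q := ZSHom.ext' h h'
  rw [this]

theorem ZS.composable {a b : Mor (ZS φ)} (h : a.s = b.r) :
    A.obj (ZS.snd a).s = (ZS.fst b).r :=
  (congrArg A.obj (ZS.snd_s a)).trans ((congrArg A.obj h).trans (ZS.fst_r b).symm)

theorem ZS.fst_comp (a b : Mor (ZS φ)) (h : a.s = b.r) :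
    ZS.fst (a.comp b h) = (ZS.fst a).comp (A.act (ZS.snd a) (ZS.fst b) (ZS.composable h))
      ((ZS.match' a).trans (A.act_r _ _ _).symm) := by
  obtain ⟨s, r, p⟩ := a
  obtain ⟨s', r', q⟩ := b
  dsimp at h
  subst h
  simp only [Mor.comp, eqToHom_refl, Category.id_comp]
  rfl

theorem ZS.snd_comp (a b : Mor (ZS φ)) (h : a.s = b.r) :
    ZS.snd (a.comp b h) = (φ.toFun (ZS.snd a) (ZS.fst b) (ZS.composable h)).comp (ZS.snd b)
      (A.bijective_obj.1 ((φ.map_s _ _ _).trans (ZS.match' b))) := by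
  obtain ⟨s, r, p⟩ := a
  obtain ⟨s', r', q⟩ := b
  dsimp at h
  subst h
  simp only [Mor.comp, eqToHom_refl, Category.id_comp]
  rfl

theorem Mor.groupoid_cancel (g h k : Mor G) (e : g.s = h.r) (e' : g.s = k.r)
    (H : g.comp h e = g.comp k e') : h = k := by
  obtain ⟨a, b, f⟩ := g
  obtain ⟨a1, b1, f1⟩ := h
  obtain ⟨a2, b2, f2⟩ := k
  dsimp at e e'
  subst e e'
  simp only [Mor.comp, eqToHom_refl, Category.id_comp, Mor.mk.injEq, true_and] at H
  obtain ⟨rfl, H⟩ := H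
  rw [(cancel_mono f).1 (eq_of_heq H)]

instance [LeftCancellative C] (φ : CategoryCocycle A) : LeftCancellative (ZS φ) where
  cancel a b c h h' H := by
    have h1 := congrArg ZS.fst H
    rw [ZS.fst_comp, ZS.fst_comp] at h1
    have h2 := A.act_injective _ _ _ _ _ (LeftCancellative.cancel _ _ _ _ _ h1)
    have h3 := congrArg ZS.snd H
    rw [ZS.snd_comp, ZS.snd_comp] at h3
    refine ZS.ext h2 ?_
    have h4 := φ.toFun_congr (rfl : ZS.snd a = ZS.snd a) h2 (ZS.composable h)
    rw [Mor.comp_congr h4 rfl] at h3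
    exact Mor.groupoid_cancel _ _ _ _ _ h3

/-- `(α, g)`, for `s(α) = r(g)`, as a morphism of the Zappa–Szép product. -/
noncomputable def ZS.mk (φ : CategoryCocycle A) (α : Mor C) (g : Mor G) (h : α.s = A.obj g.r) :
    Mor (ZS φ) :=
  have hx := A.bijective_obj.2 α.r
  ⟨g.s, hx.choose, (⟨α, g, h, hx.choose_spec.symm, rfl⟩ : ZSHom A g.s hx.choose)⟩

theorem ZS.le_iff (a b : Mor (ZS φ)) : a.Le b ↔ (ZS.fst a).Le (ZS.fst b) := by
  constructor
  · rintro ⟨c, h, rfl⟩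
    rw [ZS.fst_comp]
    exact ⟨_, _, rfl⟩
  · rintro ⟨l, hl, e⟩
    have hg : A.obj (ZS.snd a).inv.s = l.r := (ZS.match' a).symm.trans hl
    have hδ : A.obj (ZS.snd a).s = (A.act (ZS.snd a).inv l hg).r :=
      (A.act_r (ZS.snd a).inv l hg).symm
    have hact : A.act (ZS.snd a) (A.act (ZS.snd a).inv l hg) hδ = l := by
      have := A.act_comp (ZS.snd a) (ZS.snd a).inv rfl l hg
      rw [← this]
      exact (A.act_congr (Mor.comp_inv _) rfl _).trans (A.act_id _ _ _)
    have hk : (φ.toFun (ZS.snd a) _ hδ).inv.s = (ZS.snd b).r := by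
      refine A.bijective_obj.1 (Eq.trans ?_ (ZS.match' b))
      rw [← e]
      change _ = l.s
      exact (φ.map_r _ _ _).trans (congrArg Mor.s hact)
    have hm : (A.act (ZS.snd a).inv l hg).s =
        A.obj ((φ.toFun (ZS.snd a) _ hδ).inv.comp (ZS.snd b) hk).r := (φ.map_s _ _ hδ).symm
    obtain ⟨m, hm1, hm2⟩ : ∃ m : Mor (ZS φ), ZS.fst m = A.act (ZS.snd a).inv l hg ∧
        ZS.snd m = (φ.toFun (ZS.snd a) _ hδ).inv.comp (ZS.snd b) hk :=
      ⟨ZS.mk φ _ _ hm, rfl, rfl⟩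
    have ham : a.s = m.r := by
      refine A.bijective_obj.1 ?_
      exact (congrArg A.obj (ZS.snd_s a)).symm.trans
        (hδ.trans ((congrArg Mor.r hm1).symm.trans (ZS.fst_r m)))
    refine ⟨m, ham, ZS.ext ?_ ?_⟩
    · rw [ZS.fst_comp, ← e]
      exact Mor.comp_congr rfl ((A.act_congr rfl hm1 _).trans hact) _
    · rw [ZS.snd_comp]
      refine (Mor.comp_congr (φ.toFun_congr rfl hm1 _) hm2 _).trans ?_
      rw [← Mor.comp_assoc _ _ _ rfl hk]
      exact (Mor.comp_congr (Mor.comp_inv _) rfl _).trans (Mor.id_comp _ _ hk)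

instance [FinitelyAligned C] (φ : CategoryCocycle A) : FinitelyAligned (ZS φ) where
  aligned a b := by
    obtain ⟨K, hK, e⟩ := FinitelyAligned.aligned (ZS.fst a) (ZS.fst b)
    have hx : ∀ γ : Mor C, ∃ w : G, A.obj w = γ.s := fun γ => A.bijective_obj.2 _
    choose w hw using hx
    refine ⟨(fun γ => ZS.mk φ γ (Mor.id (w γ)) (hw γ).symm) '' K, hK.image _, ?_⟩
    ext c
    have h1 : ∀ a : Mor (ZS φ), c ∈ a.ideal ↔ ZS.fst c ∈ (ZS.fst a).ideal :=
      fun a => ZS.le_iff a c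
    rw [Set.biUnion_image, Set.mem_inter_iff, h1, h1, ← Set.mem_inter_iff, e]
    simp only [Set.mem_iUnion, h1]
    rfl

end ZappaSzep

end LCSC

namespace LCSC

/-! ### The space of tight filters and the action of `SL C` on filters. -/

section TightGroupoid

variable {C : Type u} [Category.{v} C]

/-! The statement splits into two facts about tight groupoids and one about the Zappa–Szép product.

For every finitely aligned left cancellative category the tight groupoid is topological
(`isTopologicalGroupoid_tight`). Elements of `SL C` commute with right multiplication, so two of
them that agree at one member of a filter agree at all its extensions. A germ is thus determined by
its source and one value, and all continuity questions concern which morphisms lie in a filter. The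
delicate one is the range map: finite alignment is what makes "α is not in the range" an open
condition.

If the category is right cancellative, the groupoid is also Hausdorff
(`RightCancellative.t2Space_tight`). Suppose s and t send γ to η and η', and their germs coincide at
some filter containing γ. Then they agree at some γβ, so ηβ = η'β, hence η = η', and s and t agree
already at γ. So germs of s and t that differ at one filter containing γ differ at all of them.

Finally, pseudo-freeness and weak factorization make the Zappa–Szép product right cancellative
(`CategoryCocycle.PseudoFree.rightCancellative`). If (α,g)(γ,k) = (β,h)(γ,k), then α(g·γ) = β(h·γ)
with g·γ and h·γ of equal length, so weak factorization gives an invertible f with β = αf and f(h·γ)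
= g·γ. Pseudo-freeness first forces gh⁻¹ to be a unit, and then f to be an identity. -/

theorem Tight.isOpen_mem (α : Mor C) : IsOpen {F : Tight C | α ∈ F.carrier} :=
  TopologicalSpace.isOpen_generateFrom_of_mem (Or.inl ⟨α, rfl⟩)

theorem Tight.isOpen_notMem (α : Mor C) : IsOpen {F : Tight C | α ∉ F.carrier} :=
  TopologicalSpace.isOpen_generateFrom_of_mem (Or.inr ⟨α, rfl⟩)

/-- Distinct filters differ at some morphism, and containing that morphism is a clopen condition. -/
instance : T2Space (Tight C) where
  t2 F F' hne := by
    have h : ∃ α, ¬(α ∈ F.carrier ↔ α ∈ F'.carrier) := by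
      by_contra! h
      exact hne (Tight.ext' (Set.ext h))
    obtain ⟨α, hα⟩ := h
    by_cases hF : α ∈ F.carrier
    · have hF' : α ∉ F'.carrier := fun h => hα ⟨fun _ => h, fun _ => hF⟩
      exact ⟨_, _, Tight.isOpen_mem α, Tight.isOpen_notMem α, hF, hF',
        Set.disjoint_left.2 fun _ h h' => h' h⟩
    · have hF' : α ∈ F'.carrier := by
        by_contra h
        exact hα ⟨fun h' => (hF h').elim, fun h' => (h h').elim⟩
      exact ⟨_, _, Tight.isOpen_notMem α, Tight.isOpen_mem α, hF, hF',
        Set.disjoint_left.2 fun _ h h' => h h'⟩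

variable [LeftCancellative C]

/-- Partial bijections in `S_Λ` that agree at `γ` agree at every extension of `γ`. -/
theorem SL.agree_of_le {s t : SL C} {γ ζ η : Mor C} (hs : η ∈ s.val γ) (ht : η ∈ t.val γ)
    (h : γ.Le ζ) : ∃ ξ, η.Le ξ ∧ ξ ∈ s.val ζ ∧ ξ ∈ t.val ζ := by
  obtain ⟨β, hβ, rfl⟩ := h
  obtain ⟨h1, h2⟩ := s.right_mul hs hβ
  obtain ⟨_, h3⟩ := t.right_mul ht hβ
  exact ⟨_, ⟨β, h1, rfl⟩, h2, h3⟩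

/-- By directedness any member of F where s is defined has an extension in F that also extends γ;
there s and t agree. -/
theorem SL.act_subset_of_agree {s t : SL C} {F : Set (Mor C)} (hF : IsFilter F) {γ η : Mor C}
    (hγ : γ ∈ F) (hs : η ∈ s.val γ) (ht : η ∈ t.val γ) : s.act F ⊆ t.act F := by
  rintro δ ⟨x, hx, y, hy, hle⟩
  obtain ⟨z, hz, h1, h2⟩ := hF.directed γ hγ x hx
  obtain ⟨ξ, -, h3, h4⟩ := SL.agree_of_le hs ht h1
  obtain ⟨ξ', h5, h6⟩ := s.mono hy h2
  obtain rfl := SL.unique h3 h5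
  exact ⟨z, hz, ξ, h4, hle.trans' h6⟩

theorem SL.act_eq_of_agree {s t : SL C} {F : Set (Mor C)} (hF : IsFilter F) {γ η : Mor C}
    (hγ : γ ∈ F) (hs : η ∈ s.val γ) (ht : η ∈ t.val γ) : s.act F = t.act F :=
  (SL.act_subset_of_agree hF hγ hs ht).antisymm (SL.act_subset_of_agree hF hγ ht hs)

/-! ### Germs and the basic sets `Theta s U`. -/

/-- The germ of a pair `(s, F)`, as an element of the tight groupoid. -/
def Rep.germ {F F' : Tight C} (s : Rep F F') : Mor (Tight C) :=
  ⟨F, F', (Quotient.mk _ s : Germ F F')⟩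

theorem Rep.exists_germ_eq (g : Mor (Tight C)) : ∃ t : Rep g.s g.r, t.germ = g := by
  obtain ⟨F, F', g⟩ := g
  induction g using Quotient.ind with | _ t
  exact ⟨t, rfl⟩

/-- Unlike in `Rep.rel_iff`, the ranges are not assumed equal: agreement at one member of F already
forces s · F = t · F. -/
theorem Rep.germ_eq_iff {F F₁ F₂ : Tight C} (s : Rep F F₁) (t : Rep F F₂) :
    s.germ = t.germ ↔ ∃ γ ∈ F.carrier, ∃ η, η ∈ s.elt.val γ ∧ η ∈ t.elt.val γ := by
  constructor
  · intro h
    obtain rfl : F₁ = F₂ := congrArg Mor.r h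
    refine (s.rel_iff t).1 (Quotient.exact (s := germSetoid F F₁) ?_)
    exact eq_of_heq (Mor.mk.inj h).2.2
  · rintro ⟨γ, hγ, η, hs, ht⟩
    obtain rfl : F₁ = F₂ := Tight.ext' <| by
      rw [← s.act_eq, ← t.act_eq]
      exact SL.act_eq_of_agree F.isTight.1 hγ hs ht
    exact congrArg (fun x : Germ F F₁ => (⟨F, F₁, x⟩ : Mor (Tight C)))
      (Rep.sound ⟨γ, hγ, η, hs, ht⟩)

/-- Reduces membership in a basic set to a single common value, so that later arguments never handle
quotients of representatives with a prescribed `elt`. -/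
theorem Rep.germ_mem_Theta_iff {F F' : Tight C} (t : Rep F F') (s : SL C) (U : Set (Tight C)) :
    t.germ ∈ Theta s U ↔
      F ∈ U ∧ ∃ γ ∈ F.carrier, ∃ η, η ∈ s.val γ ∧ η ∈ t.elt.val γ := by
  constructor
  · rintro ⟨hU, t', rfl, h⟩
    refine ⟨hU, (t'.germ_eq_iff t).1 ?_⟩
    exact (congrArg (fun x : Germ F F' => (⟨F, F', x⟩ : Mor (Tight C))) h).symm
  · rintro ⟨hU, γ, hγ, η, hs, ht⟩
    refine ⟨hU, ⟨s, ⟨γ, hγ, η, hs⟩, ?_⟩, rfl, ?_⟩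
    · exact (SL.act_eq_of_agree F.isTight.1 hγ hs ht).trans t.act_eq
    · exact Rep.sound ⟨γ, hγ, η, ht, hs⟩

theorem isOpen_Theta (s : SL C) {U : Set (Tight C)} (hU : IsOpen U) : IsOpen (Theta s U) :=
  TopologicalSpace.isOpen_generateFrom_of_mem ⟨s, U, hU, rfl⟩

theorem Rep.germ_mem_Theta {F F' : Tight C} (t : Rep F F') {U : Set (Tight C)} (hU : F ∈ U) :
    t.germ ∈ Theta t.elt U := by
  obtain ⟨γ, hγ, η, hη⟩ := t.meets
  exact (t.germ_mem_Theta_iff _ _).2 ⟨hU, γ, hγ, η, hη, hη⟩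

theorem exists_rep_mem_Theta (g : Mor (Tight C)) :
    ∃ t : Rep g.s g.r, ∀ U : Set (Tight C), g.s ∈ U → g ∈ Theta t.elt U := by
  obtain ⟨t, ht⟩ := Rep.exists_germ_eq g
  refine ⟨t, fun U hU => ?_⟩
  have := t.germ_mem_Theta (U := U) hU
  rwa [ht] at this

/-! ### Continuity of source, range, inversion and product. -/

/-- The source map of the tight groupoid is continuous. -/
theorem continuous_source : Continuous (Mor.s : Mor (Tight C) → Tight C) := by
  refine ⟨fun U hU => ?_⟩
  have : (Mor.s : Mor (Tight C) → Tight C) ⁻¹' U = ⋃ s : SL C, Theta s U := by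
    ext g
    rw [Set.mem_iUnion]
    constructor
    · intro hg
      obtain ⟨t, ht⟩ := exists_rep_mem_Theta g
      exact ⟨t.elt, ht U hg⟩
    · rintro ⟨s, hg, -⟩
      exact hg
  rw [this]
  exact isOpen_iUnion fun s => isOpen_Theta s hU

/-- The range map of the tight groupoid is continuous. -/
theorem continuous_range [FinitelyAligned C] :
    Continuous (Mor.r : Mor (Tight C) → Tight C) := by
  refine continuous_generateFrom_iff.2 ?_
  rintro _ (⟨α, rfl⟩ | ⟨α, rfl⟩) <;> refine isOpen_iff_forall_mem_open.2 fun g hg => ?_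
  · obtain ⟨t, ht⟩ := exists_rep_mem_Theta g
    change α ∈ g.r.carrier at hg
    rw [← t.act_eq] at hg
    obtain ⟨γ, hγ, η, hη, hle⟩ := hg
    -- A germ of `t.elt` at any filter containing γ has η, hence also α, in its range.
    refine ⟨Theta t.elt {E | γ ∈ E.carrier}, ?_, isOpen_Theta _ (Tight.isOpen_mem γ),
      ht _ hγ⟩
    rintro g' ⟨hγ', t', ht', -⟩
    exact g'.r.isTight.1.hereditary _ _
      (t'.image_mem hγ' (show η ∈ t'.elt.val γ by rw [ht']; exact hη)) hle
  · obtain ⟨t, ht⟩ := exists_rep_mem_Theta g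
    change α ∉ g.r.carrier at hg
    obtain ⟨γ, hγ, η, hη⟩ := t.meets
    -- Once η is in the range filter, α is in it exactly when some ε ∈ K is. Pulling K back along
    -- `t.elt` gives finitely many ζ, and V excludes these from the source filter.
    obtain ⟨K, hK, hJ⟩ := FinitelyAligned.aligned η α
    let V : Set (Tight C) := {E | γ ∈ E.carrier} ∩
      ⋂ ε ∈ K, ⋂ ζ ∈ {ζ | ε ∈ t.elt.val ζ}, {E | ζ ∉ E.carrier}
    have hsub : ∀ ε, {ζ | ε ∈ t.elt.val ζ}.Finite := fun ε =>
      Set.Subsingleton.finite fun x hx y hy => SL.inj hx hy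
    have hV : IsOpen V := (Tight.isOpen_mem γ).inter <|
      hK.isOpen_biInter fun ε _ => (hsub ε).isOpen_biInter fun ζ _ => Tight.isOpen_notMem ζ
    have hK' : ∀ ε ∈ K, η.Le ε ∧ α.Le ε := by
      intro ε hε
      have : ε ∈ η.ideal ∩ α.ideal := by
        rw [hJ]
        exact Set.mem_biUnion hε (Mor.Le.rfl' ε)
      exact this
    refine ⟨Theta t.elt V, ?_, isOpen_Theta _ hV, ht V ⟨hγ, ?_⟩⟩
    · rintro g' ⟨⟨hγ', hE⟩, t', ht', -⟩ hα
      change α ∈ g'.r.carrier at hα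
      have hη' : η ∈ t'.elt.val γ := by rw [ht']; exact hη
      obtain ⟨ξ, hξ, h1, h2⟩ :=
        g'.r.isTight.1.directed _ (t'.image_mem hγ' hη') _ hα
      have h3 : ξ ∈ η.ideal ∩ α.ideal := ⟨h1, h2⟩
      rw [hJ] at h3
      obtain ⟨ε, hε, h4⟩ := Set.mem_iUnion₂.1 h3
      have h5 : ε ∈ g'.r.carrier := g'.r.isTight.1.hereditary _ _ hξ h4
      -- The inverse of `t'.elt` is defined at η, hence at its extension ε, so ε does have a
      -- preimage ζ.
      obtain ⟨ζ, hζ, -⟩ := t'.elt.star.mono (SL.mem_star.2 hη') (hK' ε hε).1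
      have h6 : ζ ∈ g'.s.carrier := t'.inv.image_mem h5 hζ
      rw [SL.mem_star, ht'] at hζ
      exact (Set.mem_iInter₂.1 (Set.mem_iInter₂.1 hE ε hε) ζ hζ) h6
    · refine Set.mem_iInter₂.2 fun ε hε => Set.mem_iInter₂.2 fun ζ hζ hmem => hg ?_
      exact g.r.isTight.1.hereditary _ _ (t.image_mem hmem hζ) (hK' ε hε).2

theorem Rep.inv_germ {F F' : Tight C} (t : Rep F F') : t.germ.inv = t.inv.germ := rfl

/-- The `eqToHom` inside `Mor.comp` is an identity here, and `Category.id_comp` removes it. -/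
theorem Rep.comp_germ {F₀ F F' : Tight C} (s : Rep F F') (t : Rep F₀ F)
    (h : s.germ.s = t.germ.r) : s.germ.comp t.germ h = (s.mul t).germ :=
  congrArg (Mor.mk F₀ F') (congrArg (CategoryStruct.comp (t.germ.hom : F₀ ⟶ F))
    (Category.id_comp (s.germ.hom : F ⟶ F')))

/-- Inversion turns the condition on the source into one on the range, so its continuity rests on
`continuous_range`. -/
theorem preimage_inv_Theta (s : SL C) (U : Set (Tight C)) :
    (Mor.inv : Mor (Tight C) → Mor (Tight C)) ⁻¹' Theta s U =
      Mor.r ⁻¹' U ∩ Theta s.star Set.univ := by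
  ext g
  obtain ⟨t, ht⟩ := Rep.exists_germ_eq g
  rw [← ht, Set.mem_preimage, Rep.inv_germ, Rep.germ_mem_Theta_iff, Set.mem_inter_iff,
    Rep.germ_mem_Theta_iff]
  refine and_congr Iff.rfl ⟨?_, ?_⟩
  · rintro ⟨γ, hγ, η, h1, h2⟩
    exact ⟨trivial, η, t.inv.image_mem hγ h2, γ, SL.mem_star.2 h1, SL.mem_star.1 h2⟩
  · rintro ⟨-, γ, hγ, η, h1, h2⟩
    exact ⟨η, t.image_mem hγ h2, γ, SL.mem_star.1 h1, SL.mem_star.2 h2⟩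

/-- The tight groupoid of a finitely aligned left cancellative small category is a topological
groupoid. -/
theorem isTopologicalGroupoid_tight [FinitelyAligned C] : IsTopologicalGroupoid (Tight C) where
  continuous_inv := by
    refine continuous_generateFrom_iff.2 ?_
    rintro _ ⟨s, U, hU, rfl⟩
    rw [preimage_inv_Theta]
    exact (hU.preimage continuous_range).inter (isOpen_Theta _ isOpen_univ)
  continuous_comp := by
    refine continuous_generateFrom_iff.2 ?_
    rintro _ ⟨s, U, hU, rfl⟩
    refine isOpen_iff_forall_mem_open.2 ?_
    rintro ⟨⟨⟨F, F', p⟩, ⟨F₀, F₁, q⟩⟩, e⟩ hpq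
    dsimp at e
    subst e
    induction p using Quotient.ind with | _ a
    induction q using Quotient.ind with | _ b
    change a.germ.comp b.germ rfl ∈ Theta s U at hpq
    rw [Rep.comp_germ _ _ rfl, Rep.germ_mem_Theta_iff] at hpq
    obtain ⟨hF, γ, hγ, η, hs, hab⟩ := hpq
    obtain ⟨ζ, hb, ha⟩ := SL.mem_mul.1 hab
    -- The composite sends γ to ζ to η. Germs of `b.elt` at filters containing γ and of `a.elt` at
    -- filters containing ζ retain these values, so their products still send γ to η, as s does.
    let V₁ : Set (Mor (Tight C)) := Theta a.elt {E | ζ ∈ E.carrier}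
    let V₂ : Set (Mor (Tight C)) := Theta b.elt (U ∩ {E | γ ∈ E.carrier})
    refine ⟨Subtype.val ⁻¹' (V₁ ×ˢ V₂), ?_,
      ((isOpen_Theta _ (Tight.isOpen_mem ζ)).prod
        (isOpen_Theta _ (hU.inter (Tight.isOpen_mem γ)))).preimage continuous_subtype_val,
      a.germ_mem_Theta (b.image_mem hγ hb), b.germ_mem_Theta ⟨hF, hγ⟩⟩
    rintro ⟨⟨⟨E, E', p⟩, ⟨E₀, E₁, q⟩⟩, e⟩ ⟨⟨-, a', ha', hp⟩, ⟨hE, hγ'⟩, b', hb', hq⟩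
    dsimp at e
    subst e
    dsimp at a' b' ha' hb' hp hq
    subst hp hq
    change a'.germ.comp b'.germ rfl ∈ Theta s U
    rw [Rep.comp_germ _ _ rfl, Rep.germ_mem_Theta_iff]
    refine ⟨hE, γ, hγ', η, hs, SL.mem_mul.2 ⟨ζ, ?_, ?_⟩⟩
    · rw [hb']; exact hb
    · rw [ha']; exact ha

/-! ### Right cancellation and the Hausdorff property. -/

variable (C) in
/-- `αγ = βγ` implies `α = β`. -/
def RightCancellative : Prop :=
  ∀ (α β γ : Mor C) (h : α.s = γ.r) (h' : β.s = γ.r), α.comp γ h = β.comp γ h' → α = β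

/-- The tight groupoid of a right cancellative category is Hausdorff. -/
theorem RightCancellative.t2Space_tight (hC : RightCancellative C) :
    T2Space (Mor (Tight C)) where
  t2 g g' hne := by
    by_cases hs : g.s = g'.s
    · obtain ⟨F, F₁, g⟩ := g
      obtain ⟨F', F₂, g'⟩ := g'
      dsimp at hs
      subst hs
      induction g using Quotient.ind with | _ s
      induction g' using Quotient.ind with | _ t
      change s.germ ≠ t.germ at hne
      obtain ⟨γ₁, hγ₁, η₁, hη₁⟩ := s.meets
      obtain ⟨γ₂, hγ₂, η₂, hη₂⟩ := t.meets
      -- γ is a member of F at which both s and t are defined; the separating sets are their germs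
      -- over all filters containing γ.
      obtain ⟨γ, hγ, h1, h2⟩ := F.isTight.1.directed _ hγ₁ _ hγ₂
      obtain ⟨η, hη, -⟩ := s.elt.mono hη₁ h1
      obtain ⟨η', hη', -⟩ := t.elt.mono hη₂ h2
      have hU := Tight.isOpen_mem γ
      refine ⟨_, _, isOpen_Theta s.elt hU, isOpen_Theta t.elt hU, s.germ_mem_Theta hγ,
        t.germ_mem_Theta hγ, Set.disjoint_left.2 ?_⟩
      intro k hk hk'
      obtain ⟨w, hw⟩ := Rep.exists_germ_eq k
      rw [← hw, Rep.germ_mem_Theta_iff] at hk hk'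
      obtain ⟨hγk, x, hx, y, hsx, hwx⟩ := hk
      obtain ⟨-, x', hx', y', htx', hwx'⟩ := hk'
      -- The common germ k agrees with s at x and with t at x', so s and t agree at z, a common
      -- extension of x, x' and γ. Writing z = γβ makes right cancellation applicable.
      obtain ⟨z₁, hz₁, h3, h4⟩ := k.s.isTight.1.directed _ hx _ hx'
      obtain ⟨z, hz, h5, h6⟩ := k.s.isTight.1.directed _ hz₁ _ hγk
      obtain ⟨ξ, -, h7, h8⟩ := SL.agree_of_le hsx hwx (h3.trans' h5)
      obtain ⟨ξ', -, h9, h10⟩ := SL.agree_of_le htx' hwx' (h4.trans' h5)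
      obtain rfl := SL.unique h8 h10
      obtain ⟨β, hβ, rfl⟩ := h6
      obtain ⟨e1, h11⟩ := s.elt.right_mul hη hβ
      obtain ⟨e2, h12⟩ := t.elt.right_mul hη' hβ
      have e3 := hC _ _ _ e1 e2 ((SL.unique h11 h7).trans (SL.unique h9 h12))
      subst e3
      exact hne ((s.germ_eq_iff t).2 ⟨γ, hγ, η, hη, hη'⟩)
    · obtain ⟨U, V, hU, hV, h1, h2, h3⟩ := t2_separation hs
      exact ⟨_, _, hU.preimage continuous_source, hV.preimage continuous_source, h1, h2,
        h3.preimage _⟩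

end TightGroupoid

/-! ### Invertible morphisms and weak factorization. -/

section ZappaSzep

variable {C : Type u} [Category.{v} C] {Q : Type uQ} [Group Q] {Γ : Submonoid Q}
  {d : LengthFunction C Γ} {G : Type u₁} [Groupoid.{v₁} G] {A : GroupoidAction d G}

/-- In a left cancellative category right invertible elements are invertible. -/
theorem exists_inverse_of_mem_invertibles [LeftCancellative C] {f : Mor C}
    (hf : f ∈ invertibles C) :
    ∃ (k : Mor C) (h : f.s = k.r) (h' : k.s = f.r), f.comp k h = Mor.id f.r ∧
      k.comp f h' = Mor.id f.s := by
  obtain ⟨k, h, e⟩ := hf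
  have hr : f.r = k.s := congrArg Mor.r e
  refine ⟨k, h, hr.symm, by rw [e, hr], ?_⟩
  refine LeftCancellative.cancel f _ _ h rfl ?_
  rw [← Mor.comp_assoc f k f h hr.symm]
  refine (Mor.comp_congr e rfl _).trans ?_
  exact (Mor.id_comp _ _ hr.symm).trans (Mor.comp_id f _ rfl).symm

theorem Mor.comp_comp_of_comp_eq_id {f k α : Mor C} {h : f.s = k.r} {x : C}
    (e : f.comp k h = Mor.id x) (hα : k.s = α.r) : f.comp (k.comp α hα) h = α := by
  have hx : x = α.r := (congrArg Mor.s e).symm.trans hα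
  rw [← Mor.comp_assoc]
  exact (Mor.comp_congr e rfl _).trans (Mor.id_comp _ _ hx)

theorem comp_mem_invertibles {f k : Mor C} (hf : f ∈ invertibles C) (hk : k ∈ invertibles C)
    (h : f.s = k.r) : f.comp k h ∈ invertibles C := by
  obtain ⟨f', h1, e1⟩ := hf
  obtain ⟨k', h2, e2⟩ := hk
  have hr : k.r = k'.s := congrArg Mor.r e2
  have h3 : k'.s = f'.r := hr.symm.trans (h.symm.trans h1)
  refine ⟨k'.comp f' h3, h2, ?_⟩
  rw [Mor.comp_assoc]
  exact (Mor.comp_congr rfl (Mor.comp_comp_of_comp_eq_id e2 h3) _).trans e1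

/-- If `αμ = βν` with `d(μ) = d(ν)`, then `α = βf` and `fμ = ν` up to an invertible `f`. -/
theorem LengthFunction.WFP.exists_invertible [LeftCancellative C] (hd : d.WFP)
    {α β μ ν : Mor C} (h : α.s = μ.r) (h' : β.s = ν.r) (e : α.comp μ h = β.comp ν h')
    (hl : d.toFun μ = d.toFun ν) :
    ∃ f ∈ invertibles C, ∃ (h₁ : β.s = f.r) (h₂ : f.s = μ.r),
      α = β.comp f h₁ ∧ f.comp μ h₂ = ν := by
  -- Lengths lie in a group, so the equal factors d(μ) = d(ν) cancel on the right.
  have hlα : d.toFun α = d.toFun β := by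
    have h1 := d.map_comp α μ h
    rw [e, d.map_comp, hl] at h1
    have h2 := congrArg Subtype.val h1
    exact (Subtype.ext (mul_right_cancel h2)).symm
  -- Both factorizations are compared with the reference one: α = α₁g₁ and β = α₁g₁', so f =
  -- g₁'⁻¹g₁.
  obtain ⟨α₁, α₂, -, -, -, -, H⟩ := hd (α.comp μ h) _ _ (d.map_comp α μ h)
  obtain ⟨g₁, hg₁, -, -, k₁, -, e₁, -⟩ := H α μ h rfl rfl rfl
  obtain ⟨g₁', hg₁', -, -, k₁', -, e₁', -⟩ := H β ν h' hlα.symm hl.symm e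
  obtain ⟨k, a1, a2, b1, b2⟩ := exists_inverse_of_mem_invertibles hg₁'
  have hk : k ∈ invertibles C := ⟨g₁', a2, by rw [b2, a1]⟩
  have h3 : k.s = g₁.r := a2.trans (k₁'.symm.trans k₁)
  subst e₁ e₁'
  refine ⟨k.comp g₁ h3, comp_mem_invertibles hk hg₁ h3, a1, h, ?_, ?_⟩
  · rw [Mor.comp_assoc]
    exact Mor.comp_congr rfl (Mor.comp_comp_of_comp_eq_id b1 h3).symm _
  -- Cancels β from β(fμ) = αμ = βν.
  · refine LeftCancellative.cancel (α₁.comp g₁' k₁') _ _ a1 h' ?_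
    rw [← e, Mor.comp_assoc, Mor.comp_assoc α₁ g₁]
    refine Mor.comp_congr rfl ?_ _
    rw [← Mor.comp_assoc g₁' _ μ]
    exact Mor.comp_congr (Mor.comp_comp_of_comp_eq_id b1 h3) rfl _

theorem GroupoidAction.act_act_inv (A : GroupoidAction d G) (g : Mor G) (α : Mor C)
    (h : A.obj g.s = α.r) :
    A.act g.inv (A.act g α h) (A.act_r g α h).symm = α := by
  rw [← A.act_comp g.inv g rfl α h]
  exact (A.act_congr (Mor.inv_comp g) rfl _).trans (A.act_id _ _ _)

theorem Mor.groupoid_cancel_right {g h k : Mor G} (e : g.s = k.r) (e' : h.s = k.r)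
    (H : g.comp k e = h.comp k e') : g = h := by
  have key : ∀ (x : Mor G) (hx : x.s = k.r), (x.comp k hx).comp k.inv rfl = x := fun x hx =>
    (Mor.comp_assoc x k k.inv hx rfl).trans
      ((Mor.comp_congr rfl (Mor.comp_inv k) _).trans (Mor.comp_id _ _ hx))
  rw [← key g e, ← key h e']
  exact Mor.comp_congr H rfl _

/-! ### Right cancellation in the Zappa–Szép product. -/

/-- The Zappa–Szép product of a pseudo-free category system is right cancellative. -/
theorem CategoryCocycle.PseudoFree.rightCancellative [LeftCancellative C] {φ : CategoryCocycle A}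
    (hφ : φ.PseudoFree) (hd : d.WFP) : RightCancellative (ZS φ) := by
  intro a b c h h' H
  have hgk : (ZS.snd a).s = (ZS.snd b).inv.r :=
    (ZS.snd_s a).trans (h.trans (h'.symm.trans (ZS.snd_s b).symm))
  have H1 := congrArg ZS.fst H
  have H2 := congrArg ZS.snd H
  rw [ZS.fst_comp, ZS.fst_comp] at H1
  rw [ZS.snd_comp, ZS.snd_comp] at H2
  have H3 := Mor.groupoid_cancel_right _ _ H2
  have hla : ∀ (g : Mor G) (α : Mor C) (h), d.toFun (A.act g α h) = d.toFun α := fun g α h =>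
    PartialIso.map_length (A.toFunctor.map g.hom) ⟨α, h.symm⟩
  obtain ⟨f, hf, k1, k2, e1, e2⟩ :=
    hd.exists_invertible _ _ H1.symm ((hla _ _ _).trans (hla _ _ _).symm)
  -- `f` satisfies `b = a f` and `f (h · c) = g · c` on first components.
  have hc := A.act_act_inv (ZS.snd b) (ZS.fst c) (ZS.composable h')
  -- With a = (α,g), b = (β,h) and γ the first component of c, this is gh⁻¹·(h·γ) = g·γ = f(h·γ).
  have hact : A.act ((ZS.snd a).comp (ZS.snd b).inv hgk) (A.act (ZS.snd b) (ZS.fst c)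
      (ZS.composable h')) (A.act_r _ _ _).symm = f.comp _ k2 := by
    rw [A.act_comp, e2]
    exact A.act_congr rfl hc _
  -- Comparing with hh⁻¹ avoids computing φ(h⁻¹, h·γ): by the cocycle identity the two sides are
  -- φ(g,γ) and φ(h,γ) times this common factor, and `H3` equates them. The right side is a unit
  -- because hh⁻¹ is.
  have hcoc : φ.toFun ((ZS.snd a).comp (ZS.snd b).inv hgk) (A.act (ZS.snd b) (ZS.fst c)
      (ZS.composable h')) (A.act_r _ _ _).symm =
      φ.toFun ((ZS.snd b).comp (ZS.snd b).inv rfl) (A.act (ZS.snd b) (ZS.fst c)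
      (ZS.composable h')) (A.act_r _ _ _).symm := by
    rw [φ.cocycle, φ.cocycle]
    refine Mor.comp_congr ?_ rfl _
    exact (φ.toFun_congr rfl hc _).trans (H3.trans (φ.toFun_congr rfl hc.symm _))
  obtain ⟨w, hw⟩ := A.bijective_obj.2 (A.act (ZS.snd b) (ZS.fst c) (ZS.composable h')).s
  obtain ⟨w', hw'⟩ := hφ.2 _ _ f _ k2 hf hact
    ⟨w, hw, hcoc.trans ((φ.toFun_congr (Mor.comp_inv _) rfl _).trans
      (φ.unit_map _ _ _ _ hw))⟩
  have hsnd : ZS.snd a = ZS.snd b := by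
    refine Mor.groupoid_cancel_right (k := (ZS.snd b).inv) hgk rfl ?_
    rw [Mor.comp_inv, hw']
    have : w' = (ZS.snd b).r := (congrArg Mor.s hw').symm
    rw [this]
  -- Now that g = h, the relation f(h·γ) = g·γ says that f fixes h·γ, and action-freeness applies.
  have hfid := hφ.1 f _ k2 hf (e2.trans (A.act_congr hsnd rfl _))
  refine ZS.ext ?_ hsnd
  rw [e1]
  exact ((Mor.comp_congr rfl hfid _).trans (Mor.comp_id _ _ (k1.trans (congrArg Mor.r hfid)))).symm

end ZappaSzep

end LCSC

theorem mainTheorem5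
    {Q : Type uQ} [Group Q] (Γ : Submonoid Q) (hΓ : ∀ q ∈ Γ, q⁻¹ ∈ Γ → q = 1)
    {C : Type u} [Category.{v} C] [LCSC.LeftCancellative C] [LCSC.FinitelyAligned C]
    (d : LCSC.LengthFunction C Γ) (hd : d.WFP)
    {G : Type u₁} [Groupoid.{v₁} G] (A : LCSC.GroupoidAction d G)
    (φ : LCSC.CategoryCocycle A) (hφ : φ.PseudoFree) :
    LCSC.IsTopologicalGroupoid (LCSC.Tight (LCSC.ZS φ)) ∧
      T2Space (LCSC.Mor (LCSC.Tight (LCSC.ZS φ))) :=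
  ⟨LCSC.isTopologicalGroupoid_tight, (hφ.rightCancellative hd).t2Space_tight⟩
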